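/- Let $d\ge 2$, let $\mathcal T$ be a $(d+1)$-regular tree with a fixed reference vertex $v_0$ and a legal colouring of its edges by $D=\{0,\dots,d\}$ (edges at a common vertex have different colours), and let $F\le \mathrm{Sym}(D)$ be any subgroup. Let $U(F)$ be the group of automorphisms of $\mathcal T$ whose local action at every vertex lies in $F$ (that is, the permutation of $D$ sending the colour of each edge at the vertex to the colour of its image), with the topology of pointwise convergence. Let $\mathcal N_F$ be the coloured Neretin group: the group of homeomorphisms of $\partial\mathcal T$ that agree in a neighbourhood of every point with an element of $U(F)$, with the unique group topology for which the inclusion $U(F)\hookrightarrow \mathcal N_F$ is continuous and open. Let $\mathrm{Sub}(\mathcal N_F)$ be the space of closed subgroups of $\mathcal N_F$ with the Chabauty topology; an ergodic IRS of $\mathcal N_F$ is a Borel probability measure on $\mathrm{Sub}(\mathcal N_F)$ that is invariant under conjugation by $\mathcal N_F$ and gives every conjugation-invariant Borel set measure $0$ or $1$. For vertices $v,x$ say that $x$ is a descendant of $v$ if $v$ lies on the geodesic from $v_0$ to $x$, and a child of $v$ if moreover $x$ is adjacent to $v$; let $\mathcal T_v$ be the subtree of descendants of $v$ (including $v$). A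 finite subtree $A$ of $\mathcal T$ is complete if it contains $v_0$ and contains all children of each of its vertices that is not a leaf, where a leaf of $A$ is a vertex of $A$ with no child in $A$; $\partial A$ is the set of leaves. Let $B_n(A)$ be the subtree of vertices within distance $n$ of $A$. For a finite complete subtree $A$, let $O_F^A=\bigcup_{n\ge 0}O_F^A(n)$, where $O_F^A(n)$ is the set of elements of $\mathcal N_F$ induced by an isomorphism of rooted forests $$\varphi:\coprod_{v\in\partial B_n(A)}\mathcal T_v\to\coprod_{v\in\partial B_n(A)}\mathcal T_v$$ such that for each $v\in\partial B_n(A)$ there is $h_v\in U(F)$ with $\varphi|_{\mathcal T_v}=h_v|_{\mathcal T_v}$. Let $\mu$ be an ergodic IRS of $\mathcal N_F$ with $\mu\ne\delta_{\{\mathrm{id}\}}$. Then for $\mu$-a.e. $H$ there exists a finite complete subtree $A$ of $\mathcal T$ such that $H\cap O_F^A\ne\{\mathrm{id}\}$. -/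

import Mathlib

open MeasureTheory

universe u

/-! ### Invariant random subgroups -/

namespace ClosedSubgroup

variable {G : Type u} [Group G] [TopologicalSpace G]

/-- The Chabauty topology on the space `Sub(G)` of closed subgroups: a subbasis is given by the sets
`{H | H ∩ K = ∅}` for `K` compact and `{H | H ∩ W ≠ ∅}` for `W` open. -/
instance chabautyTopology : TopologicalSpace (ClosedSubgroup G) :=
  TopologicalSpace.generateFrom
    ({S | ∃ K : Set G, IsCompact K ∧ S = {H : ClosedSubgroup G | (H : Set G) ∩ K = ∅}} ∪
      {S | ∃ W : Set G, IsOpen W ∧ S = {H : ClosedSubgroup G | ((H : Set G) ∩ W).Nonempty}})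

/-- The Borel σ-algebra of the Chabauty topology. -/
instance chabautyMeasurableSpace : MeasurableSpace (ClosedSubgroup G) := borel _

/-- The closed subgroup `g H g⁻¹ = {x | g⁻¹ x g ∈ H}`. -/
def conj [SeparatelyContinuousMul G] (g : G) (H : ClosedSubgroup G) : ClosedSubgroup G where
  toSubgroup := H.toSubgroup.comap (MulAut.conj g⁻¹).toMonoidHom
  isClosed' := H.isClosed'.preimage (f := fun x => g⁻¹ * x * g⁻¹⁻¹)
    ((continuous_mul_const _).comp (continuous_const_mul _))

/-- The trivial closed subgroup `{id}`. -/
def trivial (G : Type u) [Group G] [TopologicalSpace G] [T1Space G] : ClosedSubgroup G where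
  toSubgroup := ⊥
  isClosed' := isClosed_singleton

/-- `μ` is an ergodic invariant random subgroup of `G`: a Borel probability measure on `Sub(G)`,
invariant under conjugation, for which every conjugation-invariant Borel set is null or conull. -/
structure IsErgodicIRS [SeparatelyContinuousMul G] (μ : Measure (ClosedSubgroup G)) : Prop where
  isProbabilityMeasure : IsProbabilityMeasure μ
  invariant : ∀ (g : G) (S : Set (ClosedSubgroup G)), MeasurableSet S → μ (conj g ⁻¹' S) = μ S
  ergodic : ∀ S : Set (ClosedSubgroup G), MeasurableSet S → (∀ g : G, conj g ⁻¹' S = S) →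
    μ S = 0 ∨ μ S = 1

end ClosedSubgroup

/-! ### Trees, boundaries, coloured Neretin groups -/

/-- A `(d+1)`-regular tree with a reference point and a legal colouring of its edges by
`D = {0, …, d}`. The values of `col` at pairs of vertices that are not edges are never used. -/
structure ColouredTree (d : ℕ) where
  V : Type u
  graph : SimpleGraph V
  isTree : graph.IsTree
  regular : ∀ v, (graph.neighborSet v).ncard = d + 1
  root : V
  col : Sym2 V → Fin (d + 1)
  legal : ∀ v w w', graph.Adj v w → graph.Adj v w' → w ≠ w' → col s(v, w) ≠ col s(v, w')

namespace ColouredTree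

variable {d : ℕ} (T : ColouredTree.{u} d)

/-- `u` lies on the geodesic from the root to `v`. -/
def Below (u v : T.V) : Prop :=
  T.graph.dist T.root u + T.graph.dist u v = T.graph.dist T.root v

/-- `w` is a child of `v`. -/
def IsChild (v w : T.V) : Prop :=
  T.graph.Adj v w ∧ T.graph.dist T.root w = T.graph.dist T.root v + 1

/-- The vertex set of the subtree `𝒯_v` rooted at `v`. -/
def subtreeAt (v : T.V) : Set T.V := {x | T.Below v x}

/-- The leaves `∂A` of a subtree `A` containing the root: the vertices of `A` without children in
`A`. In particular the root is the leaf of `A = {v₀}`. -/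
def leaves (A : Set T.V) : Set T.V := {v | v ∈ A ∧ ∀ w, T.IsChild v w → w ∉ A}

/-- Finite complete subtrees (given by their vertex sets): `A` is finite, contains the root, is
connected (that is, contains the geodesic from the root to each of its vertices), and contains all
children of each of its vertices that is not a leaf. -/
structure IsFiniteComplete (A : Set T.V) : Prop where
  finite : A.Finite
  root_mem : T.root ∈ A
  connected : ∀ v ∈ A, ∀ u, T.Below u v → u ∈ A
  complete : ∀ v ∈ A, v ∉ T.leaves A → ∀ w, T.IsChild v w → w ∈ A

/-- `B_n(A)`: the vertices within distance `n` of `A`. -/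
def nbhd (n : ℕ) (A : Set T.V) : Set T.V := {x | ∃ a ∈ A, T.graph.dist a x ≤ n}

/-- The boundary `∂𝒯`: infinite geodesic rays starting at the root. -/
@[ext]
structure Boundary where
  toFun : ℕ → T.V
  start : toFun 0 = T.root
  adj : ∀ n, T.graph.Adj (toFun n) (toFun (n + 1))
  dist_eq : ∀ n, T.graph.dist T.root (toFun n) = n

/-- `C_v`: the rays passing through `v`. -/
def cylinder (v : T.V) : Set T.Boundary := {ω | ∃ n, ω.toFun n = v}

instance : TopologicalSpace T.Boundary :=
  TopologicalSpace.generateFrom (Set.range T.cylinder)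

variable {T}

/-- `ω'` is the image of the boundary point `ω` under the map `f` of vertices: the path `f ∘ ω` and
the ray `ω'` have a common tail. (It is enough that `f` is meaningful far out on the ray `ω`.) For an
automorphism `f` of the tree this is the graph of the action of `f` on the boundary. -/
def IsImage (f : T.V → T.V) (ω ω' : T.Boundary) : Prop :=
  ∃ m k, ∀ n, f (ω.toFun (n + m)) = ω'.toFun (n + k)

/-- The homeomorphism `φ` of the boundary is induced by the map `f` of vertices. -/
def Induces (f : T.V → T.V) (φ : T.Boundary ≃ₜ T.Boundary) : Prop :=
  ∀ ω, IsImage f ω (φ ω)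

lemma IsImage.comp {f g : T.V → T.V} {ω ω' ω'' : T.Boundary} (hf : IsImage f ω ω')
    (hg : IsImage g ω' ω'') : IsImage (g ∘ f) ω ω'' := by
  obtain ⟨m, k, h⟩ := hf
  obtain ⟨m', k', h'⟩ := hg
  refine ⟨m + m', k + k', fun n => ?_⟩
  have e1 := h (n + m')
  have e2 := h' (n + k)
  rw [show n + m' + m = n + (m + m') by omega, show n + m' + k = n + k + m' by omega] at e1
  rw [Function.comp_apply, e1, e2]
  congr 1
  omega

lemma IsImage.id (ω : T.Boundary) : IsImage (fun x => x) ω ω := ⟨0, 0, fun _ => rfl⟩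

lemma IsImage.symm {g : T.graph ≃g T.graph} {ω ω' : T.Boundary} (h : IsImage g ω ω') :
    IsImage (g⁻¹ : T.graph ≃g T.graph) ω' ω := by
  obtain ⟨m, k, h⟩ := h
  refine ⟨k, m, fun n => ?_⟩
  rw [← h n]
  exact g.symm_apply_apply _

variable (T)

/-- The Burger–Mozes universal group `U(F)`: the automorphisms `g` of the tree whose local action at
every vertex `v`, the permutation of `D` that takes the colour of an edge `{v, w}` to the colour of
`{g v, g w}`, is in `F`. -/
def universalGroup (F : Subgroup (Equiv.Perm (Fin (d + 1)))) : Subgroup (T.graph ≃g T.graph) where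
  carrier := {g | ∀ v, ∃ σ ∈ F, ∀ w, T.graph.Adj v w → T.col s(g v, g w) = σ (T.col s(v, w))}
  one_mem' := fun _ => ⟨1, F.one_mem, fun _ _ => rfl⟩
  mul_mem' := by
    intro g h hg hh v
    obtain ⟨σ, hσ, h1⟩ := hh v
    obtain ⟨τ, hτ, h2⟩ := hg (h v)
    refine ⟨τ * σ, F.mul_mem hτ hσ, fun w hw => ?_⟩
    have := h2 (h w) (h.map_adj_iff.2 hw)
    rw [h1 w hw] at this
    exact this
  inv_mem' := by
    intro g hg v
    obtain ⟨σ, hσ, h1⟩ := hg (g⁻¹ v)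
    refine ⟨σ⁻¹, F.inv_mem hσ, fun w hw => ?_⟩
    have h2 := h1 (g⁻¹ w) ((g⁻¹).map_adj_iff.2 hw)
    have e : ∀ x, g (g⁻¹ x) = x := fun x => g.apply_symm_apply x
    rw [e, e] at h2
    rw [h2]
    simp

/-- The underlying group of the coloured Neretin group `𝒩_F`: the topological full group of the
action of `U(F)` on the boundary, that is, the homeomorphisms of the boundary that agree near every
point with (the action of) an element of `U(F)`. -/
def fullGroup (F : Subgroup (Equiv.Perm (Fin (d + 1)))) : Subgroup (T.Boundary ≃ₜ T.Boundary) where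
  carrier := {φ | ∀ ω, ∃ W ∈ nhds ω, ∃ g ∈ T.universalGroup F, ∀ ω' ∈ W, IsImage g ω' (φ ω')}
  one_mem' := fun _ => ⟨Set.univ, Filter.univ_mem, 1, one_mem _, fun ω' _ => IsImage.id ω'⟩
  mul_mem' := by
    intro φ ψ hφ hψ ω
    obtain ⟨W, hW, g, hg, h⟩ := hψ ω
    obtain ⟨W', hW', g', hg', h'⟩ := hφ (ψ ω)
    refine ⟨W ∩ ψ ⁻¹' W', Filter.inter_mem hW (ψ.continuous.continuousAt hW'), g' * g,
      mul_mem hg' hg, fun ω' hω' => ?_⟩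
    exact (h ω' hω'.1).comp (h' (ψ ω') hω'.2)
  inv_mem' := by
    intro φ hφ ω
    obtain ⟨W, hW, g, hg, h⟩ := hφ (φ.symm ω)
    refine ⟨φ.symm ⁻¹' W, φ.symm.continuous.continuousAt hW, g⁻¹, inv_mem hg, fun ω' hω' => ?_⟩
    have := (h (φ.symm ω') hω').symm
    rwa [φ.apply_symm_apply] at this

/-- The coloured Neretin group `𝒩_F`. -/
def NeretinGroup (F : Subgroup (Equiv.Perm (Fin (d + 1)))) : Type u := T.fullGroup F

namespace NeretinGroup

variable {T} {F : Subgroup (Equiv.Perm (Fin (d + 1)))}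

noncomputable instance : Group (T.NeretinGroup F) :=
  inferInstanceAs (Group (T.fullGroup F))

/-- The homeomorphism of the boundary given by an element of `𝒩_F`. -/
def toHomeo (φ : T.NeretinGroup F) : T.Boundary ≃ₜ T.Boundary := φ.1

/-- The image in `𝒩_F` of the pointwise stabilizer in `U(F)` of the set `L` of vertices. For finite
`L` these stabilizers form a basis of neighbourhoods of the identity in `U(F)`. -/
def stab (F : Subgroup (Equiv.Perm (Fin (d + 1)))) (L : Set T.V) : Set (T.NeretinGroup F) :=
  {φ | ∃ g ∈ T.universalGroup F, (∀ x ∈ L, g x = x) ∧ Induces g φ.toHomeo}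

/-- The topology of `𝒩_F`: the topology generated by the left and right translates of the images of
the basic open subsets of `U(F)`. Every group topology for which the inclusion of `U(F)` into `𝒩_F` is
continuous and open contains all these sets, and its open sets are unions of such left translates:
so this is the unique group topology for which `U(F) → 𝒩_F` is continuous and open. -/
instance : TopologicalSpace (T.NeretinGroup F) :=
  TopologicalSpace.generateFrom
    {S | ∃ (a b : T.NeretinGroup F) (L : Set T.V), L.Finite ∧
      S = {x | ∃ y ∈ stab F L, x = a * y * b}}

instance : SeparatelyContinuousMul (T.NeretinGroup F) where
  continuous_const_mul := by
    intro c
    refine continuous_generateFrom_iff.2 ?_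
    rintro S ⟨a, b, L, hL, rfl⟩
    refine TopologicalSpace.isOpen_generateFrom_of_mem ⟨c⁻¹ * a, b, L, hL, ?_⟩
    ext x
    refine exists_congr fun y => and_congr_right fun _ => ?_
    rw [mul_assoc c⁻¹, mul_assoc c⁻¹, eq_inv_mul_iff_mul_eq]
  continuous_mul_const := by
    intro c
    refine continuous_generateFrom_iff.2 ?_
    rintro S ⟨a, b, L, hL, rfl⟩
    refine TopologicalSpace.isOpen_generateFrom_of_mem ⟨a, b * c⁻¹, L, hL, ?_⟩
    ext x
    refine exists_congr fun y => and_congr_right fun _ => ?_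
    rw [← mul_assoc, eq_mul_inv_iff_mul_eq]

end NeretinGroup

variable {T}

lemma parent_unique {u u' v : T.V} {n : ℕ} (hu : T.graph.Adj u v) (hu' : T.graph.Adj u' v)
    (h : T.graph.dist T.root u = n) (h' : T.graph.dist T.root u' = n)
    (hv : T.graph.dist T.root v = n + 1) : u = u' := by
  obtain ⟨p, hp⟩ := T.isTree.connected.exists_walk_length_eq_dist T.root u
  obtain ⟨p', hp'⟩ := T.isTree.connected.exists_walk_length_eq_dist T.root u'
  have h1 : (p.concat hu).IsPath := SimpleGraph.Walk.isPath_of_length_eq_dist _ (by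
    rw [SimpleGraph.Walk.length_concat, hp, h, hv])
  have h2 : (p'.concat hu').IsPath := SimpleGraph.Walk.isPath_of_length_eq_dist _ (by
    rw [SimpleGraph.Walk.length_concat, hp', h', hv])
  have h3 := (T.isTree.existsUnique_path T.root v).unique h1 h2
  have h4 := congrArg SimpleGraph.Walk.penultimate h3
  simpa using h4

/-- An automorphism fixing the root acts on rays vertex by vertex. -/
lemma IsImage.apply_eq {g : T.graph ≃g T.graph} (hg : g T.root = T.root) {ω ω' : T.Boundary}
    (h : IsImage g ω ω') (n : ℕ) : g (ω.toFun n) = ω'.toFun n := by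
  have hd : ∀ x, T.graph.dist T.root (g x) = T.graph.dist T.root x := by
    have key : ∀ (f : T.graph ≃g T.graph), f T.root = T.root → ∀ x,
        T.graph.dist T.root (f x) ≤ T.graph.dist T.root x := by
      intro f hf x
      obtain ⟨p, hp⟩ := T.isTree.connected.exists_walk_length_eq_dist T.root x
      have := SimpleGraph.dist_le (p.map f.toHom)
      rw [SimpleGraph.Walk.length_map, hp] at this
      change T.graph.dist (f T.root) (f x) ≤ _ at this
      rwa [hf] at this
    intro x
    refine le_antisymm (key g hg x) ?_
    have := key g.symm (by rw [RelIso.symm_apply_eq]; exact hg.symm) (g x)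
    rwa [g.symm_apply_apply] at this
  obtain ⟨m, k, h⟩ := h
  have hmk : m = k := by
    have := congrArg (T.graph.dist T.root) (h 0)
    rw [hd, ω.dist_eq, ω'.dist_eq] at this
    omega
  subst hmk
  have hstep : ∀ j, g (ω.toFun (j + 1)) = ω'.toFun (j + 1) → g (ω.toFun j) = ω'.toFun j := by
    intro j hj
    refine parent_unique (v := ω'.toFun (j + 1)) (n := j) ?_ (ω'.adj j) ?_ (ω'.dist_eq j)
      (ω'.dist_eq _)
    · rw [← hj]
      exact g.map_adj_iff.2 (ω.adj j)
    · rw [hd, ω.dist_eq]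
  have hdown : ∀ i j, g (ω.toFun (j + i)) = ω'.toFun (j + i) → g (ω.toFun j) = ω'.toFun j := by
    intro i
    induction i with
    | zero => intro j hj; exact hj
    | succ i ih => intro j hj; exact ih j (hstep _ hj)
  exact hdown m n (h n)

instance (F : Subgroup (Equiv.Perm (Fin (d + 1)))) : T1Space (T.NeretinGroup F) := by
  have hone : ∀ φ : T.NeretinGroup F, φ ≠ 1 → ∃ L : Set T.V, L.Finite ∧
      φ ∉ NeretinGroup.stab F L := by
    intro φ hφ
    obtain ⟨ω, hω⟩ : ∃ ω, φ.toHomeo ω ≠ ω := by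
      by_contra hcon
      push Not at hcon
      exact hφ (Subtype.ext (Homeomorph.ext hcon))
    obtain ⟨n, hn⟩ : ∃ n, (φ.toHomeo ω).toFun n ≠ ω.toFun n := by
      by_contra hcon
      push Not at hcon
      exact hω (Boundary.ext (funext hcon))
    refine ⟨{T.root, ω.toFun n}, by simp, ?_⟩
    rintro ⟨g, -, hfix, hind⟩
    have h1 := (hind ω).apply_eq (hfix _ (by simp)) n
    rw [hfix _ (by simp)] at h1
    exact hn h1.symm
  refine t1Space_iff_exists_open.2 fun x y hxy => ?_
  obtain ⟨L, hL, hy⟩ := hone (x⁻¹ * y) (fun h => hxy (inv_mul_eq_one.1 h))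
  refine ⟨{z | ∃ w ∈ NeretinGroup.stab F L, z = x * w * 1},
    TopologicalSpace.isOpen_generateFrom_of_mem ⟨x, 1, L, hL, rfl⟩, ?_, ?_⟩
  · exact ⟨1, ⟨1, one_mem _, fun _ _ => rfl, fun ω => IsImage.id ω⟩, by simp⟩
  · rintro ⟨w, hw, rfl⟩
    apply hy
    simpa using hw

/-! ### Representing triples and the groups `O_F^A` -/

variable (T)

/-- The vertex set of the forest `𝒯 ∖ A = ∐_{v ∈ ∂A} 𝒯_v`. -/
def forest (A : Set T.V) : Set T.V := {x | ∃ v ∈ T.leaves A, x ∈ T.subtreeAt v}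

variable {T}

/-- `ψ` restricts to an isomorphism of rooted forests `𝒯 ∖ A → 𝒯 ∖ B`; the values of `ψ` outside
`𝒯 ∖ A` are never used. -/
structure IsForestIso (A B : Set T.V) (ψ : T.V → T.V) : Prop where
  bijOn : Set.BijOn ψ (T.forest A) (T.forest B)
  bijOn_leaves : Set.BijOn ψ (T.leaves A) (T.leaves B)
  adj_iff : ∀ x ∈ T.forest A, ∀ y ∈ T.forest A, T.graph.Adj (ψ x) (ψ y) ↔ T.graph.Adj x y

/-- The `U(F)`-almost automorphism `φ` is represented by the triple `(A, B, ψ)`: `ψ` is a forest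
isomorphism `𝒯 ∖ A → 𝒯 ∖ B` which coincides on each `𝒯_v`, `v ∈ ∂A`, with an element of `U(F)`, and
`φ` is the homeomorphism of the boundary induced by `ψ`. -/
structure NeretinGroup.IsRepresentedBy {F : Subgroup (Equiv.Perm (Fin (d + 1)))}
    (φ : T.NeretinGroup F) (A B : Set T.V) (ψ : T.V → T.V) : Prop where
  forestIso : IsForestIso A B ψ
  locally_universal : ∀ v ∈ T.leaves A, ∃ h ∈ T.universalGroup F, ∀ x ∈ T.subtreeAt v, ψ x = h x
  induces : Induces ψ φ.toHomeo

/-- `O_F^A(n)`: the elements of `𝒩_F` represented by a triple `(B_n(A), B_n(A), ψ)`. -/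
def OLevel (F : Subgroup (Equiv.Perm (Fin (d + 1)))) (A : Set T.V) (n : ℕ) :
    Set (T.NeretinGroup F) :=
  {φ | ∃ ψ, φ.IsRepresentedBy (T.nbhd n A) (T.nbhd n A) ψ}

/-- `O_F^A = ⋃ₙ O_F^A(n)`. -/
def OGroup (F : Subgroup (Equiv.Perm (Fin (d + 1)))) (A : Set T.V) : Set (T.NeretinGroup F) :=
  ⋃ n, OLevel F A n

end ColouredTree

namespace ColouredTree

variable {d : ℕ} {T : ColouredTree.{u} d}

/-! ### Depth, parents and descendants -/

/-- The distance to the root. -/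
noncomputable def depth (T : ColouredTree.{u} d) (x : T.V) : ℕ := T.graph.dist T.root x

@[simp]
lemma depth_root : T.depth T.root = 0 := SimpleGraph.dist_self

lemma depth_eq_zero {x : T.V} : T.depth x = 0 ↔ x = T.root := by
  rw [depth, T.isTree.connected.dist_eq_zero_iff, eq_comm]

lemma depth_pos {x : T.V} : 1 ≤ T.depth x ↔ x ≠ T.root := by
  rw [Nat.one_le_iff_ne_zero, ne_eq, depth_eq_zero]

lemma IsChild.depth_eq {v w : T.V} (h : T.IsChild v w) : T.depth w = T.depth v + 1 := h.2

lemma IsChild.ne_root {v w : T.V} (h : T.IsChild v w) : w ≠ T.root := by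
  have := h.depth_eq
  exact depth_pos.1 (by omega)

lemma isChild_or_isChild_of_adj {u v : T.V} (h : T.graph.Adj u v) :
    T.IsChild u v ∨ T.IsChild v u := by
  rcases T.isTree.dist_eq_dist_add_one_of_adj T.root h with h1 | h1
  · exact Or.inr ⟨h.symm, h1⟩
  · exact Or.inl ⟨h, h1⟩

lemma exists_adj_dist_eq {x u : T.V} (hx : x ≠ u) :
    ∃ y, T.graph.Adj x y ∧ T.graph.dist u x = T.graph.dist u y + 1 := by
  obtain ⟨p, hp⟩ := T.isTree.connected.exists_walk_length_eq_dist x u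
  cases p with
  | nil => exact absurd rfl hx
  | @cons _ y _ h q =>
    refine ⟨y, h, ?_⟩
    have h1 := SimpleGraph.dist_le q
    rw [SimpleGraph.Walk.length_cons] at hp
    rw [SimpleGraph.dist_comm (u := u) (v := x), SimpleGraph.dist_comm (u := u) (v := y)]
    have h2 := T.isTree.connected.dist_triangle (u := x) (v := y) (w := u)
    have h3 := SimpleGraph.dist_eq_one_iff_adj.2 h
    omega

lemma exists_isChild_to {x : T.V} (hx : x ≠ T.root) : ∃ p, T.IsChild p x := by
  obtain ⟨y, h1, h2⟩ := exists_adj_dist_eq hx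
  exact ⟨y, h1.symm, h2⟩

open Classical in
/-- The parent of a vertex (the root being its own parent). -/
noncomputable def par (x : T.V) : T.V :=
  if hx : x ≠ T.root then (exists_isChild_to hx).choose else T.root

lemma isChild_par {x : T.V} (hx : x ≠ T.root) : T.IsChild (par x) x := by
  rw [par, dif_pos hx]
  exact (exists_isChild_to hx).choose_spec

lemma IsChild.eq_of {p q x : T.V} (hp : T.IsChild p x) (hq : T.IsChild q x) : p = q := by
  have h1 := hp.depth_eq
  have h2 := hq.depth_eq
  exact parent_unique hp.1 hq.1 rfl (by change T.depth q = T.depth p; omega) hp.2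

lemma IsChild.par_eq {p x : T.V} (hp : T.IsChild p x) : par x = p :=
  (isChild_par hp.ne_root).eq_of hp

lemma isChild_of_adj_of_ne_par {x y : T.V} (h : T.graph.Adj x y) (hy : y ≠ par x) :
    T.IsChild x y :=
  (isChild_or_isChild_of_adj h).resolve_right fun h' => hy h'.par_eq.symm

lemma below_iff {u x : T.V} :
    T.Below u x ↔ T.depth u + T.graph.dist u x = T.depth x := Iff.rfl

lemma depth_le_add (u x : T.V) : T.depth x ≤ T.depth u + T.graph.dist u x :=
  T.isTree.connected.dist_triangle

lemma Below.refl (x : T.V) : T.Below x x := by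
  rw [below_iff, SimpleGraph.dist_self, add_zero]

lemma Below.trans {u v w : T.V} (h : T.Below u v) (h' : T.Below v w) : T.Below u w := by
  rw [below_iff] at *
  have h1 := T.isTree.connected.dist_triangle (u := u) (v := v) (w := w)
  have h2 := depth_le_add u w
  omega

lemma Below.depth_le {u v : T.V} (h : T.Below u v) : T.depth u ≤ T.depth v := by
  rw [below_iff] at h
  omega

lemma Below.eq_of_depth_le {u v : T.V} (h : T.Below u v) (h' : T.depth v ≤ T.depth u) :
    u = v := by
  rw [below_iff] at h
  exact T.isTree.connected.dist_eq_zero_iff.1 (by omega)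

lemma root_below (x : T.V) : T.Below T.root x := by
  rw [below_iff, depth_root, zero_add]
  rfl

lemma IsChild.below {v w : T.V} (h : T.IsChild v w) : T.Below v w := by
  rw [below_iff, h.depth_eq, SimpleGraph.dist_eq_one_iff_adj.2 h.1]

lemma Below.par {u x : T.V} (h : T.Below u x) (hne : u ≠ x) :
    T.Below u (par x) ∧ T.IsChild (ColouredTree.par x) x := by
  obtain ⟨y, h1, h2⟩ := exists_adj_dist_eq hne.symm
  rw [below_iff] at h
  have h3 := depth_le_add u y
  have hc : T.IsChild y x := by
    rcases isChild_or_isChild_of_adj h1 with hc | hc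
    · have := hc.depth_eq
      omega
    · exact hc
  have h4 := hc.depth_eq
  rw [hc.par_eq]
  exact ⟨by rw [below_iff]; omega, hc⟩

lemma Below.of_isChild {u y x : T.V} (h : T.Below u x) (hne : u ≠ x) (hy : T.IsChild y x) :
    T.Below u y := hy.par_eq ▸ (h.par hne).1

lemma Below.induction {u : T.V} {P : T.V → Prop} (h0 : P u)
    (h1 : ∀ y z, T.Below u y → P y → T.IsChild y z → P z) {x : T.V} (hx : T.Below u x) : P x := by
  induction hn : T.depth x generalizing x with
  | zero =>
    rw [hx.eq_of_depth_le (by omega)] at h0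
    exact h0
  | succ n ih =>
    by_cases hux : u = x
    · exact hux ▸ h0
    · obtain ⟨h2, h3⟩ := hx.par hux
      exact h1 _ _ h2 (ih h2 (by have := h3.depth_eq; omega)) h3

lemma Below.of_below {u v x : T.V} (hu : T.Below u x) (hv : T.Below v x)
    (h : T.depth u ≤ T.depth v) : T.Below u v := by
  revert hu
  refine Below.induction (u := v) (P := fun x => T.Below u x → T.Below u v) id
    (fun y z hy ih hz huz => ih (huz.of_isChild ?_ hz)) hv
  rintro rfl
  have h1 := hy.depth_le
  have h2 := hz.depth_eq
  omega

lemma Below.exists_isChild {u x : T.V} (h : T.Below u x) (hne : u ≠ x) :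
    ∃ w, T.IsChild u w ∧ T.Below w x := by
  refine (Below.induction (P := fun x => u = x ∨ ∃ w, T.IsChild u w ∧ T.Below w x)
    (Or.inl rfl) ?_ h).resolve_left hne
  rintro y z - (rfl | ⟨w, hw, hwy⟩) hz
  · exact Or.inr ⟨z, hz, Below.refl z⟩
  · exact Or.inr ⟨w, hw, hwy.trans hz.below⟩

/-! ### Neighbours by colour -/

lemma finite_neighborSet (v : T.V) : (T.graph.neighborSet v).Finite :=
  Set.finite_of_ncard_ne_zero (by rw [T.regular v]; omega)

lemma exists_adj_col (v : T.V) (c : Fin (d + 1)) : ∃ w, T.graph.Adj v w ∧ T.col s(v, w) = c := by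
  have hinj : Set.InjOn (fun w => T.col s(v, w)) (T.graph.neighborSet v) := by
    intro w hw w' hw' h
    by_contra hne
    exact T.legal v w w' hw hw' hne h
  have h1 : ((fun w => T.col s(v, w)) '' T.graph.neighborSet v).ncard = d + 1 := by
    rw [hinj.ncard_image, T.regular v]
  have h2 : (fun w => T.col s(v, w)) '' T.graph.neighborSet v = Set.univ :=
    Set.eq_of_subset_of_ncard_le (Set.subset_univ _) (by simp [h1, Set.ncard_univ])
  have h3 : c ∈ (fun w => T.col s(v, w)) '' T.graph.neighborSet v := h2 ▸ Set.mem_univ c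
  exact h3

/-- The neighbour of `v` along the edge of colour `c`. -/
noncomputable def nb (v : T.V) (c : Fin (d + 1)) : T.V := (exists_adj_col v c).choose

lemma adj_nb (v : T.V) (c : Fin (d + 1)) : T.graph.Adj v (nb v c) :=
  (exists_adj_col v c).choose_spec.1

lemma col_nb (v : T.V) (c : Fin (d + 1)) : T.col s(v, nb v c) = c :=
  (exists_adj_col v c).choose_spec.2

lemma nb_col {v w : T.V} (h : T.graph.Adj v w) : nb v (T.col s(v, w)) = w := by
  by_contra hne
  exact T.legal v _ _ (adj_nb _ _) h hne (col_nb _ _)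

lemma nb_injective (v : T.V) : Function.Injective (nb v) := fun a b h => by
  rw [← col_nb v a, h, col_nb]

lemma isChild_nb {v : T.V} {c : Fin (d + 1)} (h : c ≠ T.col s(par v, v)) :
    T.IsChild v (nb v c) := by
  refine isChild_of_adj_of_ne_par (adj_nb v c) fun h' => h ?_
  rw [← col_nb v c, h', Sym2.eq_swap]

lemma exists_isChild_ne (hd : 2 ≤ d) (v w : T.V) : ∃ z, T.IsChild v z ∧ z ≠ w := by
  obtain ⟨c, hc⟩ : ∃ c, c ∉ ({T.col s(par v, v), T.col s(v, w)} : Finset (Fin (d + 1))) := by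
    by_contra! hcon
    have h1 := Finset.card_le_card (fun c _ => hcon c : (Finset.univ : Finset (Fin (d + 1))) ⊆ _)
    have h2 := Finset.card_le_two (a := T.col s(par v, v)) (b := T.col s(v, w))
    rw [Finset.card_univ, Fintype.card_fin] at h1
    omega
  simp only [Finset.mem_insert, Finset.mem_singleton, not_or] at hc
  refine ⟨nb v c, isChild_nb hc.1, fun h => hc.2 ?_⟩
  rw [← h, col_nb]

/-! ### Spheres -/

lemma finite_sphere (n : ℕ) : {x : T.V | T.depth x = n}.Finite := by
  induction n with
  | zero =>
    refine (Set.finite_singleton T.root).subset fun x hx => ?_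
    exact depth_eq_zero.1 hx
  | succ n ih =>
    refine (ih.biUnion fun v _ => finite_neighborSet v).subset fun x hx => ?_
    have hx' : T.depth x = n + 1 := hx
    have h := isChild_par (depth_pos.1 (by omega : 1 ≤ T.depth x))
    have := h.depth_eq
    exact Set.mem_biUnion (show par x ∈ {x : T.V | T.depth x = n} from
      (by omega : T.depth (par x) = n)) h.1

instance : Countable T.V := by
  rw [← Set.countable_univ_iff]
  have : (Set.univ : Set T.V) = ⋃ n, {x : T.V | T.depth x = n} := by
    ext x
    simp
  rw [this]
  exact Set.countable_iUnion fun n => (finite_sphere n).countable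

/-! ### Rays -/

namespace Boundary

lemma depth_apply (ω : T.Boundary) (n : ℕ) : T.depth (ω.toFun n) = n := ω.dist_eq n

lemma isChild (ω : T.Boundary) (n : ℕ) : T.IsChild (ω.toFun n) (ω.toFun (n + 1)) :=
  ⟨ω.adj n, by rw [ω.dist_eq, ω.dist_eq]⟩

lemma below (ω : T.Boundary) {i j : ℕ} (h : i ≤ j) : T.Below (ω.toFun i) (ω.toFun j) := by
  induction j, h using Nat.le_induction with
  | base => exact Below.refl _
  | succ j _ ih => exact ih.trans (ω.isChild j).below

lemma apply_depth_of_below {ω : T.Boundary} {v : T.V} {n : ℕ} (h : T.Below v (ω.toFun n)) :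
    ω.toFun (T.depth v) = v := by
  have h1 := h.depth_le
  rw [depth_apply] at h1
  refine ((ω.below h1).of_below h ?_).eq_of_depth_le ?_ <;> rw [depth_apply]

lemma apply_ne_root (ω : T.Boundary) {n : ℕ} (h : 1 ≤ n) : ω.toFun n ≠ T.root :=
  depth_pos.1 (by rwa [depth_apply])

lemma par_apply_succ (ω : T.Boundary) (n : ℕ) : par (ω.toFun (n + 1)) = ω.toFun n :=
  (ω.isChild n).par_eq

lemma apply_eq_of_le {ω η : T.Boundary} {n m : ℕ} (h : ω.toFun n = η.toFun n) (hm : m ≤ n) :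
    ω.toFun m = η.toFun m := by
  have h1 := ω.below hm
  rw [h] at h1
  have h2 := apply_depth_of_below h1
  rw [depth_apply] at h2
  exact h2.symm

lemma ext_tail {ω η : T.Boundary} (N : ℕ) (h : ∀ n, ω.toFun (N + n) = η.toFun (N + n)) :
    ω = η :=
  Boundary.ext (funext fun n => apply_eq_of_le (h n) (by omega))

lemma exists_of_tail (m : ℕ) (f : ℕ → T.V) (h0 : T.depth (f 0) = m)
    (hf : ∀ n, T.IsChild (f n) (f (n + 1))) :
    ∃ ω : T.Boundary, ∀ n, ω.toFun (m + n) = f n := by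
  induction m generalizing f with
  | zero =>
    have hd : ∀ n, T.depth (f n) = n := by
      intro n
      induction n with
      | zero => exact h0
      | succ n ih => rw [(hf n).depth_eq, ih]
    exact ⟨⟨f, depth_eq_zero.1 h0, fun n => (hf n).1, hd⟩, fun n => by rw [zero_add]⟩
  | succ m ih =>
    have hp := isChild_par (depth_pos.1 (by omega : 1 ≤ T.depth (f 0)))
    obtain ⟨ω, hω⟩ := ih (fun n => Nat.casesOn n (par (f 0)) f)
      (by have := hp.depth_eq; change T.depth (par (f 0)) = m; omega)
      (fun n => by
        cases n with
        | zero => exact hp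
        | succ n => exact hf n)
    refine ⟨ω, fun n => ?_⟩
    rw [show m + 1 + n = m + (n + 1) by omega]
    exact hω (n + 1)

lemma exists_apply_eq (hd : 2 ≤ d) (v : T.V) : ∃ ω : T.Boundary, ω.toFun (T.depth v) = v := by
  have hc : ∀ x : T.V, ∃ y, T.IsChild x y := fun x =>
    let ⟨y, h, _⟩ := exists_isChild_ne hd x x
    ⟨y, h⟩
  choose f hf using hc
  obtain ⟨ω, hω⟩ := exists_of_tail (T.depth v) (fun n => f^[n] v) rfl (fun n => by
    rw [Function.iterate_succ_apply']
    exact hf _)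
  exact ⟨ω, hω 0⟩

lemma mem_cylinder {ω : T.Boundary} {v : T.V} : ω ∈ T.cylinder v ↔ ω.toFun (T.depth v) = v := by
  refine ⟨?_, fun h => ⟨_, h⟩⟩
  rintro ⟨n, rfl⟩
  rw [depth_apply]

lemma mem_nhds_iff_exists {ω : T.Boundary} {W : Set T.Boundary} :
    W ∈ nhds ω ↔ ∃ n, ∀ η : T.Boundary, η.toFun n = ω.toFun n → η ∈ W := by
  constructor
  · intro hW
    obtain ⟨U, hUW, hU, hωU⟩ := mem_nhds_iff.1 hW
    suffices h : ∃ n, ∀ η : T.Boundary, η.toFun n = ω.toFun n → η ∈ U from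
      h.imp fun n hn η hη => hUW (hn η hη)
    clear hUW hW
    induction hU with
    | basic S hS =>
      obtain ⟨v, rfl⟩ := hS
      rw [mem_cylinder] at hωU
      exact ⟨T.depth v, fun η hη => mem_cylinder.2 (hη.trans hωU)⟩
    | univ => exact ⟨0, fun _ _ => trivial⟩
    | inter S S' _ _ ih ih' =>
      obtain ⟨n, hn⟩ := ih hωU.1
      obtain ⟨m, hm⟩ := ih' hωU.2
      exact ⟨max n m, fun η hη => ⟨hn η (apply_eq_of_le hη (le_max_left _ _)),
        hm η (apply_eq_of_le hη (le_max_right _ _))⟩⟩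
    | sUnion 𝒮 _ ih =>
      obtain ⟨S, hS, hωS⟩ := hωU
      obtain ⟨n, hn⟩ := ih S hS hωS
      exact ⟨n, fun η hη => ⟨S, hS, hn η hη⟩⟩
  · rintro ⟨n, hn⟩
    refine Filter.mem_of_superset (IsOpen.mem_nhds (TopologicalSpace.isOpen_generateFrom_of_mem
      ⟨ω.toFun n, rfl⟩) ⟨n, rfl⟩ : T.cylinder (ω.toFun n) ∈ nhds ω) fun η hη => hn η ?_
    rw [mem_cylinder, depth_apply] at hη
    exact hη

end Boundary

/-- König's lemma: a hereditary property that holds eventually along every ray holds at every vertex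
of some sphere. -/
lemma exists_uniform_depth {P : T.V → Prop} (hP : ∀ v w, T.IsChild v w → P v → P w)
    (h : ∀ ω : T.Boundary, ∃ n, P (ω.toFun n)) (N : ℕ) :
    ∃ R, N ≤ R ∧ ∀ v, T.depth v = R → P v := by
  have hmono : ∀ {v x}, T.Below v x → P v → P x := fun {v x} hx hv =>
    Below.induction (P := P) hv (fun y z _ hy hz => hP y z hz hy) hx
  by_contra! hcon
  let Bad : T.V → Prop := fun v => ∀ R, ∃ x, T.Below v x ∧ R ≤ T.depth x ∧ ¬ P x
  have hroot : Bad T.root := fun R => by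
    obtain ⟨x, hx, hx'⟩ := hcon (max N R) (le_max_left _ _)
    exact ⟨x, root_below x, hx ▸ le_max_right _ _, hx'⟩
  have hstep : ∀ v, Bad v → ∃ w, T.IsChild v w ∧ Bad w := by
    intro v hv
    by_contra! hno
    have hno' : ∀ w : T.V, ∃ R, T.IsChild v w → ∀ x, T.Below w x → R ≤ T.depth x → P x := by
      intro w
      by_cases hw : T.IsChild v w
      · have := hno w hw
        simp only [Bad] at this
        push Not at this
        obtain ⟨R, hR⟩ := this
        exact ⟨R, fun _ => hR⟩
      · exact ⟨0, fun h => absurd h hw⟩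
    choose R hR using hno'
    obtain ⟨M, hM⟩ := ((finite_neighborSet v).image R).bddAbove
    obtain ⟨x, hx, hxd, hxP⟩ := hv (max M (T.depth v + 1))
    obtain ⟨w, hw, hwx⟩ := hx.exists_isChild (by
      rintro rfl
      have := le_max_right M (T.depth v + 1)
      omega)
    exact hxP (hR w hw x hwx (((hM ⟨w, hw.1, rfl⟩).trans (le_max_left _ _)).trans hxd))
  choose! f hf hf' using hstep
  have hbad : ∀ n, Bad (f^[n] T.root) := by
    intro n
    induction n with
    | zero => exact hroot
    | succ n ih => rw [Function.iterate_succ_apply']; exact hf' _ ih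
  obtain ⟨ω, hω⟩ := Boundary.exists_of_tail 0 (fun n => f^[n] T.root) depth_root (fun n => by
    rw [Function.iterate_succ_apply']
    exact hf _ (hbad n))
  obtain ⟨n, hn⟩ := h ω
  obtain ⟨x, hx, -, hxP⟩ := hbad n 0
  refine hxP (hmono hx ?_)
  rwa [← hω n, zero_add]

end ColouredTree

namespace ColouredTree

variable {d : ℕ} {T : ColouredTree.{u} d} {F : Subgroup (Equiv.Perm (Fin (d + 1)))}

/-! ### Maps carrying one subtree to another -/

lemma apply_below {h : T.graph ≃g T.graph} {v x : T.V}
    (hp : h (par v) = par (h v)) (hx : T.Below v x) :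
    T.Below (h v) (h x) ∧ T.depth (h x) + T.depth v = T.depth x + T.depth (h v) ∧
      h (par x) = par (h x) := by
  refine Below.induction (P := fun x => T.Below (h v) (h x) ∧
    T.depth (h x) + T.depth v = T.depth x + T.depth (h v) ∧ h (par x) = par (h x))
    ⟨Below.refl _, add_comm _ _, hp⟩ ?_ hx
  rintro y z - ⟨h1, h2, h3⟩ hyz
  have hne : h z ≠ par (h y) := by
    rw [← h3]
    intro he
    have hz : z = par y := h.injective he
    have hy : y ≠ T.root := by
      rintro rfl
      have e1 : par T.root = T.root := by simp [par]
      rw [e1] at hz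
      exact hyz.ne_root hz
    have e1 := hyz.depth_eq
    have e2 := (isChild_par hy).depth_eq
    rw [← hz] at e2
    omega
  have hc : T.IsChild (h y) (h z) := isChild_of_adj_of_ne_par (h.map_adj_iff.2 hyz.1) hne
  refine ⟨h1.trans hc.below, ?_, ?_⟩
  · have e1 := hyz.depth_eq
    have e2 := hc.depth_eq
    omega
  · rw [hyz.par_eq, hc.par_eq]

lemma exists_image_ray {h : T.graph ≃g T.graph} {v : T.V} (hp : h (par v) = par (h v))
    {ω : T.Boundary} (hω : ω.toFun (T.depth v) = v) :
    ∃ η : T.Boundary, ∀ n, η.toFun (T.depth (h v) + n) = h (ω.toFun (T.depth v + n)) := by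
  have hb : ∀ n, T.depth (h (ω.toFun (T.depth v + n))) = T.depth (h v) + n := fun n => by
    have := ω.below (show T.depth v ≤ T.depth v + n by omega)
    rw [hω] at this
    have := (apply_below hp this).2.1
    rw [Boundary.depth_apply] at this
    omega
  refine Boundary.exists_of_tail (T.depth (h v)) (fun n => h (ω.toFun (T.depth v + n))) (hb 0)
    fun n => ⟨h.map_adj_iff.2 (ω.adj _), ?_⟩
  change T.depth _ = T.depth _ + 1
  rw [hb, hb, add_assoc]

/-- The map `k` of the boundary carries `C_v` to `C_w` by an element of `U(F)` that maps the subtree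
`𝒯_v` onto `𝒯_w`. -/
def Carries (F : Subgroup (Equiv.Perm (Fin (d + 1)))) (k : T.Boundary → T.Boundary)
    (v w : T.V) : Prop :=
  v ≠ T.root ∧ w ≠ T.root ∧ ∃ h ∈ T.universalGroup F, h v = w ∧ h (par v) = par w ∧
    ∀ ω : T.Boundary, ω.toFun (T.depth v) = v →
      ∀ n, (k ω).toFun (T.depth w + n) = h (ω.toFun (T.depth v + n))

namespace Carries

variable {k k' : T.Boundary → T.Boundary} {v w x : T.V}

lemma apply_eq (h : Carries F k v w) {ω : T.Boundary} (hω : ω.toFun (T.depth v) = v) :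
    (k ω).toFun (T.depth w) = w := by
  obtain ⟨-, -, g, -, hgv, -, h1⟩ := h
  have := h1 ω hω 0
  rwa [add_zero, add_zero, hω, hgv] at this

lemma comp (h : Carries F k v w) (h' : Carries F k' w x) : Carries F (k' ∘ k) v x := by
  have ha := fun ω => h.apply_eq (ω := ω)
  obtain ⟨hv, -, g, hg, hgv, hgp, h1⟩ := h
  obtain ⟨-, hx, g', hg', hgv', hgp', h1'⟩ := h'
  refine ⟨hv, hx, g' * g, mul_mem hg' hg, ?_, ?_, fun ω hω n => ?_⟩
  · change g' (g v) = x
    rw [hgv, hgv']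
  · change g' (g (par v)) = par x
    rw [hgp, hgp']
  · change (k' (k ω)).toFun _ = g' (g _)
    rw [h1' (k ω) (ha ω hω) n, h1 ω hω n]

lemma below (h : Carries F k v w) {y : T.V} (hy : T.Below v y) :
    ∃ z, Carries F k y z ∧ T.depth z + T.depth v = T.depth y + T.depth w := by
  obtain ⟨hv, hw, g, hg, rfl, hgp, h1⟩ := h
  obtain ⟨h2, h3, h4⟩ := apply_below hgp hy
  refine ⟨g y, ⟨?_, ?_, g, hg, rfl, h4, fun ω hω n => ?_⟩, h3⟩
  · exact depth_pos.1 ((depth_pos.2 hv).trans hy.depth_le)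
  · exact depth_pos.1 ((depth_pos.2 hw).trans h2.depth_le)
  · obtain ⟨j, hj⟩ := Nat.exists_eq_add_of_le hy.depth_le
    have hωv : ω.toFun (T.depth v) = v := by
      rw [← hω] at hy
      exact Boundary.apply_depth_of_below hy
    have := h1 ω hωv (j + n)
    rw [show T.depth (g y) + n = T.depth (g v) + (j + n) by omega,
      show T.depth y + n = T.depth v + (j + n) by omega]
    exact this

lemma shift {ω : T.Boundary} {n m : ℕ} (h : Carries F k (ω.toFun n) ((k ω).toFun m)) (j : ℕ) :
    Carries F k (ω.toFun (n + j)) ((k ω).toFun (m + j)) := by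
  obtain ⟨z, hz, h1⟩ := h.below (ω.below (by omega : n ≤ n + j))
  simp only [Boundary.depth_apply] at h1
  have h2 := hz.apply_eq (ω := ω) (by rw [Boundary.depth_apply])
  rw [show T.depth z = m + j by omega] at h2
  rwa [h2]

lemma congr {n : ℕ} {ω : T.Boundary} (h : Carries F k (ω.toFun n) w) {η : T.Boundary}
    (hη : η.toFun n = ω.toFun n) (m : ℕ) : η.toFun (n + m) = ω.toFun (n + m) →
    (k η).toFun (T.depth w + m) = (k ω).toFun (T.depth w + m) := by
  obtain ⟨-, -, g, hg, hgv, hgp, h1⟩ := h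
  have e1 := h1 ω (by rw [Boundary.depth_apply]) m
  have e2 := h1 η (by rw [Boundary.depth_apply, hη]) m
  rw [Boundary.depth_apply] at e1 e2
  intro he
  rw [e1, e2, he]

lemma symm {k : T.Boundary ≃ₜ T.Boundary} (h : Carries F k v w) : Carries F k.symm w v := by
  obtain ⟨hv, hw, g, hg, rfl, hgp, h1⟩ := h
  have e1 : g⁻¹ (g v) = v := g.symm_apply_apply v
  have e2 : g⁻¹ (par (g v)) = par v := by
    rw [← hgp]
    exact g.symm_apply_apply _
  have e3 : ∀ y, g (g⁻¹ y) = y := g.apply_symm_apply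
  refine ⟨hw, hv, g⁻¹, inv_mem hg, e1, e2, fun ω hω => ?_⟩
  obtain ⟨η, hη⟩ := exists_image_ray (h := g⁻¹) (by rw [e1, e2]) hω
  rw [e1] at hη
  have hkη : k η = ω := by
    refine Boundary.ext_tail (T.depth (g v)) fun n => ?_
    rw [h1 η ?_ n, hη n, e3]
    have := hη 0
    rwa [add_zero, add_zero, hω, e1] at this
  intro n
  rw [← hη n, ← hkη, k.symm_apply_apply]

end Carries

lemma exists_apply_eq_of_isImage {g : T.graph ≃g T.graph} (hg : g ∈ T.universalGroup F) {v w : T.V}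
    (hv : v ≠ T.root) (hw : w ≠ T.root) (hgv : g v = w) (hgp : g (par v) = par w)
    {k : T.Boundary → T.Boundary}
    (hk : ∀ ω : T.Boundary, ω.toFun (T.depth v) = v → IsImage g ω (k ω)) : Carries F k v w := by
  refine ⟨hv, hw, g, hg, hgv, hgp, fun ω hω n => ?_⟩
  subst hgv
  obtain ⟨η, hη⟩ := exists_image_ray hgp hω
  obtain ⟨a, b, hab⟩ := hk ω hω
  have key : ∀ n, (k ω).toFun (T.depth v + n + b) = η.toFun (T.depth (g v) + (n + a)) := fun n => by
    rw [hη, ← hab, add_assoc]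
  have hd0 : b + T.depth v = T.depth (g v) + a := by
    have := congrArg T.depth (key 0)
    rw [Boundary.depth_apply, Boundary.depth_apply] at this
    omega
  have : k ω = η := by
    refine Boundary.ext_tail (T.depth v + b) fun n => ?_
    have := key n
    rw [show T.depth v + b + n = T.depth v + n + b by omega, this]
    congr 1
    omega
  rw [this, hη]

lemma exists_carries_of_mem_fullGroup {φ : T.Boundary ≃ₜ T.Boundary} (hφ : φ ∈ T.fullGroup F)
    (ω : T.Boundary) : ∃ n m, Carries F φ (ω.toFun n) ((φ ω).toFun m) := by
  obtain ⟨W, hW, g, hg, h⟩ := hφ ω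
  obtain ⟨N, hN⟩ := Boundary.mem_nhds_iff_exists.1 hW
  obtain ⟨a, b, hab⟩ := h ω (mem_of_mem_nhds hW)
  refine ⟨N + a + 1, N + b + 1, exists_apply_eq_of_isImage hg (ω.apply_ne_root (by omega))
    ((φ ω).apply_ne_root (by omega)) ?_ ?_ fun η hη => ?_⟩
  · rw [show N + a + 1 = N + 1 + a by omega, hab]
    congr 1
    omega
  · rw [Boundary.par_apply_succ, Boundary.par_apply_succ, hab]
  · rw [Boundary.depth_apply] at hη
    exact h η (hN η (Boundary.apply_eq_of_le hη (by omega)))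

lemma continuous_of_carries {k : T.Boundary → T.Boundary}
    (h : ∀ ω : T.Boundary, ∃ n w, Carries F k (ω.toFun n) w) : Continuous k := by
  refine continuous_iff_continuousAt.2 fun ω W hW => ?_
  obtain ⟨N, hN⟩ := Boundary.mem_nhds_iff_exists.1 hW
  obtain ⟨n, w, hw⟩ := h ω
  refine Boundary.mem_nhds_iff_exists.2 ⟨n + N, fun η hη => hN _ ?_⟩
  exact Boundary.apply_eq_of_le
    (hw.congr (Boundary.apply_eq_of_le hη (by omega)) N hη) (by omega)

lemma mem_fullGroup_of_carries {k : T.Boundary ≃ₜ T.Boundary}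
    (h : ∀ ω : T.Boundary, ∃ n w, Carries F k (ω.toFun n) w) : k ∈ T.fullGroup F := by
  intro ω
  obtain ⟨n, w, -, -, g, hg, -, -, h1⟩ := h ω
  refine ⟨{η | η.toFun n = ω.toFun n}, Boundary.mem_nhds_iff_exists.2 ⟨n, fun _ h => h⟩, g, hg,
    fun η hη => ⟨n, T.depth w, fun j => ?_⟩⟩
  rw [Boundary.depth_apply] at h1
  rw [add_comm j, add_comm j, h1 η hη]

/-! ### Shifts -/

/-- The almost automorphism `k` shifts depths by `c`, near every point of the boundary. -/
def HasShift (F : Subgroup (Equiv.Perm (Fin (d + 1)))) (k : T.Boundary → T.Boundary)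
    (c : T.Boundary → ℤ) : Prop :=
  ∀ ω : T.Boundary, ∃ n m : ℕ, Carries F k (ω.toFun n) ((k ω).toFun m) ∧
    ∀ η : T.Boundary, η.toFun n = ω.toFun n → c η = m - n

namespace HasShift

variable {k k' : T.Boundary → T.Boundary} {c c' : T.Boundary → ℤ}

lemma comp (h' : HasShift F k' c') (h : HasShift F k c) :
    HasShift F (k' ∘ k) (fun ω => c' (k ω) + c ω) := by
  intro ω
  obtain ⟨n, m, h1, h2⟩ := h ω
  obtain ⟨n', m', h1', h2'⟩ := h' (k ω)
  refine ⟨n + n', m + m', ?_, fun η hη => ?_⟩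
  · have e1 := h1.shift n'
    have e2 := h1'.shift m
    rw [add_comm n' m, add_comm m' m] at e2
    exact e1.comp e2
  · have e0 := Boundary.apply_eq_of_le hη (by omega : n ≤ n + n')
    have e1 := h2 η e0
    have e3 := h1.congr e0 n' hη
    rw [Boundary.depth_apply] at e3
    have e2 := h2' (k η) (Boundary.apply_eq_of_le e3 (by omega))
    push_cast
    linarith

lemma symm {k : T.Boundary ≃ₜ T.Boundary} (h : HasShift F k c) :
    HasShift F k.symm (fun ω => - c (k.symm ω)) := by
  intro ω
  obtain ⟨n, m, h1, h2⟩ := h (k.symm ω)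
  rw [k.apply_symm_apply] at h1
  refine ⟨m, n, h1.symm, fun η hη => ?_⟩
  have h3 := h1.symm.apply_eq (ω := η) (by rw [Boundary.depth_apply, hη])
  rw [Boundary.depth_apply] at h3
  dsimp only
  rw [h2 _ h3]
  ring

lemma congr (h : HasShift F k c) (hc : ∀ ω, c ω = c' ω) : HasShift F k c' := by
  rwa [← funext hc]

end HasShift

lemma exists_uniform_carries {k : T.Boundary → T.Boundary}
    (h : ∀ ω : T.Boundary, ∃ n w, Carries F k (ω.toFun n) w) (N : ℕ) :
    ∃ R, N ≤ R ∧ ∀ v, T.depth v = R → ∃ w, Carries F k v w :=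
  exists_uniform_depth (fun _ _ hvw ⟨_, hw⟩ => (hw.below hvw.below).imp fun _ h => h.1) h N

/-- The functions on the boundary that only depend on finitely many steps of a ray. -/
def levelFunctions (T : ColouredTree.{u} d) : Set (T.Boundary → ℤ) :=
  {c | ∃ (R : ℕ) (t : {v : T.V // T.depth v = R} → ℤ),
    c = fun ω => t ⟨ω.toFun R, ω.depth_apply R⟩}

lemma countable_levelFunctions : (levelFunctions T).Countable := by
  have : ∀ R, Finite {v : T.V // T.depth v = R} := fun R => (finite_sphere R).to_subtype
  refine (Set.countable_range fun p : Σ R : ℕ, ({v : T.V // T.depth v = R} → ℤ) =>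
    fun ω : T.Boundary => p.2 ⟨ω.toFun p.1, ω.depth_apply p.1⟩).mono ?_
  rintro c ⟨R, t, rfl⟩
  exact ⟨⟨R, t⟩, rfl⟩

lemma exists_hasShift {φ : T.Boundary ≃ₜ T.Boundary} (hφ : φ ∈ T.fullGroup F) :
    ∃ c ∈ levelFunctions T, HasShift F φ c := by
  obtain ⟨R, -, hR⟩ := exists_uniform_carries
    (fun ω => let ⟨n, m, h⟩ := exists_carries_of_mem_fullGroup hφ ω; ⟨n, _, h⟩) 0
  choose! f hf using hR
  refine ⟨_, ⟨R, fun v => T.depth (f v) - R, rfl⟩, fun ω => ⟨R, T.depth (f (ω.toFun R)), ?_,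
    fun η hη => ?_⟩⟩
  · have h1 := hf _ (ω.depth_apply R)
    rwa [h1.apply_eq (by rw [Boundary.depth_apply])]
  · dsimp only
    rw [hη]

/-- Elements of `U(F)` fixing the root preserve depths. -/
lemma carries_of_induces {φ : T.Boundary ≃ₜ T.Boundary} {g : T.graph ≃g T.graph}
    (hg : g ∈ T.universalGroup F) (hroot : g T.root = T.root) (hφ : Induces g φ) {v : T.V}
    (hv : v ≠ T.root) (hd : 2 ≤ d) : Carries F φ v (g v) ∧ T.depth (g v) = T.depth v := by
  obtain ⟨ω, hω⟩ := Boundary.exists_apply_eq hd v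
  have h1 := (hφ ω).apply_eq hroot
  obtain ⟨n, hn⟩ := Nat.exists_eq_add_of_le' (depth_pos.2 hv)
  rw [hn] at hω
  have h2 := h1 (n + 1)
  rw [hω] at h2
  have h3 : T.depth (g v) = T.depth v := by rw [h2, Boundary.depth_apply, hn]
  refine ⟨exists_apply_eq_of_isImage hg hv (depth_pos.1 (h3 ▸ depth_pos.2 hv)) rfl ?_
    fun η _ => hφ η, h3⟩
  rw [h2, Boundary.par_apply_succ, ← h1 n, ← hω, Boundary.par_apply_succ]

end ColouredTree

namespace ColouredTree

variable {d : ℕ} {T : ColouredTree.{u} d} {F : Subgroup (Equiv.Perm (Fin (d + 1)))}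

/-! ### Finite complete subtrees and the groups `O_F^A` -/

namespace IsFiniteComplete

variable {A : Set T.V}

lemma eq_of_below_leaves (hA : T.IsFiniteComplete A) {u v x : T.V} (hu : u ∈ T.leaves A)
    (hv : v ∈ T.leaves A) (hux : T.Below u x) (hvx : T.Below v x) : u = v := by
  have key : ∀ {u v : T.V}, u ∈ T.leaves A → v ∈ T.leaves A → T.Below u v → u = v := by
    intro u v hu hv huv
    by_contra hne
    obtain ⟨w, hw, hwv⟩ := huv.exists_isChild hne
    exact hu.2 w hw (hA.connected v hv.1 w hwv)
  rcases le_total (T.depth u) (T.depth v) with h | h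
  · exact key hu hv (hux.of_below hvx h)
  · exact (key hv hu (hvx.of_below hux h)).symm

lemma exists_mem_leaves (hA : T.IsFiniteComplete A) (ω : T.Boundary) :
    ∃ n, ω.toFun n ∈ T.leaves A := by
  classical
  have hex : ∃ n, ω.toFun n ∉ A := by
    by_contra! hcon
    have hinj : Function.Injective ω.toFun := fun i j hij => by
      rw [← ω.depth_apply i, hij, ω.depth_apply]
    exact Set.infinite_range_of_injective hinj
      (hA.finite.subset (by rintro _ ⟨n, rfl⟩; exact hcon n))
  obtain ⟨m, hm⟩ : ∃ m, Nat.find hex = m + 1 := by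
    refine Nat.exists_eq_succ_of_ne_zero fun h0 => ?_
    have := Nat.find_spec hex
    rw [h0, ω.start] at this
    exact this hA.root_mem
  have h1 : ω.toFun m ∈ A := by
    by_contra hcon
    have := Nat.find_min' hex hcon
    omega
  have h2 := Nat.find_spec hex
  rw [hm] at h2
  refine ⟨m, ?_⟩
  by_contra h3
  exact h2 (hA.complete _ h1 h3 _ (ω.isChild m))

end IsFiniteComplete

lemma nbhd_zero (A : Set T.V) : T.nbhd 0 A = A := by
  ext x
  constructor
  · rintro ⟨a, ha, h⟩
    rwa [← T.isTree.connected.dist_eq_zero_iff.1 (Nat.le_zero.1 h)]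
  · intro hx
    exact ⟨x, hx, by rw [SimpleGraph.dist_self]⟩

lemma mem_OGroup_of_carries (hd : 2 ≤ d) {A : Set T.V} (hA : T.IsFiniteComplete A)
    {φ : T.NeretinGroup F}
    (hφ : ∀ v ∈ T.leaves A, ∃ w ∈ T.leaves A, Carries F φ.toHomeo v w) : φ ∈ OGroup F A := by
  have hφ' : ∀ v ∈ T.leaves A, ∃ h ∈ T.universalGroup F, h v ∈ T.leaves A ∧
      Carries F φ.toHomeo v (h v) ∧ h (par v) = par (h v) ∧
        ∀ ω : T.Boundary, ω.toFun (T.depth v) = v →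
          ∀ n, (φ.toHomeo ω).toFun (T.depth (h v) + n) = h (ω.toFun (T.depth v + n)) := by
    intro v hv
    obtain ⟨w, hw, hvw⟩ := hφ v hv
    obtain ⟨-, -, h, hh, rfl, h2, h3⟩ := id hvw
    exact ⟨h, hh, hw, hvw, h2, h3⟩
  choose! h hU hleaf hcar hpar hray using hφ'
  have hfor : ∀ x ∈ T.forest A, ∃ v ∈ T.leaves A, T.Below v x := fun x hx => hx
  choose! l hl hlx using hfor
  have hl_eq : ∀ v ∈ T.leaves A, ∀ x, T.Below v x → l x = v := fun v hv x hx =>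
    hA.eq_of_below_leaves (hl x ⟨v, hv, hx⟩) hv (hlx x ⟨v, hv, hx⟩) hx
  have hbelow : ∀ v ∈ T.leaves A, ∀ x, T.Below v x → T.Below (h v v) (h v x) := fun v hv x hx =>
    (apply_below (hpar v hv) hx).1
  have hinj : Set.InjOn (fun v => h v v) (T.leaves A) := by
    intro v hv v' hv' hvv
    obtain ⟨ω, hω⟩ := Boundary.exists_apply_eq hd v
    have h1 := (hcar v hv).apply_eq hω
    have h2 := hcar v' hv'
    simp only at hvv
    rw [← hvv] at h2
    have h3 := h2.symm.apply_eq h1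
    rw [Homeomorph.symm_apply_apply] at h3
    refine hA.eq_of_below_leaves (x := ω.toFun (max (T.depth v) (T.depth v'))) hv hv' ?_ ?_
    · nth_rewrite 1 [← hω]
      exact ω.below (le_max_left _ _)
    · nth_rewrite 1 [← h3]
      exact ω.below (le_max_right _ _)
  have hmaps : Set.MapsTo (fun v => h v v) (T.leaves A) (T.leaves A) := fun v hv => hleaf v hv
  have hfin : (T.leaves A).Finite := hA.finite.subset fun v hv => hv.1
  have hsurj : Set.SurjOn (fun v => h v v) (T.leaves A) (T.leaves A) :=
    (Set.eq_of_subset_of_ncard_le hmaps.image_subset (by rw [hinj.ncard_image]) hfin).ge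
  have hl_self : ∀ v ∈ T.leaves A, l v = v := fun v hv => hl_eq v hv v (Below.refl v)
  have hl_of : ∀ x ∈ T.forest A, ∀ y ∈ T.forest A, ∀ z,
      T.Below (h (l x) (l x)) z → T.Below (h (l y) (l y)) z → l x = l y :=
    fun x hx y hy z hzx hzy => hinj (hl x hx) (hl y hy)
      (hA.eq_of_below_leaves (hleaf _ (hl x hx)) (hleaf _ (hl y hy)) hzx hzy)
  have hψ : ∀ x ∈ T.forest A, T.Below (h (l x) (l x)) (h (l x) x) := fun x hx =>
    hbelow _ (hl x hx) x (hlx x hx)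
  have hiso : IsForestIso A A (fun x => h (l x) x) := by
    refine ⟨⟨?_, ?_, ?_⟩, ?_, ?_⟩
    · exact fun x hx => ⟨_, hleaf _ (hl x hx), hψ x hx⟩
    · intro x hx y hy hxy
      simp only at hxy
      have h1 := hψ y hy
      rw [← hxy] at h1
      have h2 := hl_of x hx y hy _ (hψ x hx) h1
      rw [h2] at hxy
      exact (h (l y)).injective hxy
    · rintro y ⟨w, hw, hwy⟩
      obtain ⟨v, hv, rfl⟩ := hsurj hw
      have hwy' : T.Below (h v v) y := hwy
      have e1 : (h v)⁻¹ (h v v) = v := (h v).symm_apply_apply v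
      have e2 : (h v)⁻¹ (par (h v v)) = par ((h v)⁻¹ (h v v)) := by
        rw [e1, ← hpar v hv]
        exact (h v).symm_apply_apply _
      have h3 := (apply_below e2 hwy').1
      rw [e1] at h3
      refine ⟨(h v)⁻¹ y, ⟨v, hv, h3⟩, ?_⟩
      simp only
      rw [hl_eq v hv _ h3]
      exact (h v).apply_symm_apply y
    · refine Set.BijOn.congr (f₁ := fun v => h v v) ⟨hmaps, hinj, hsurj⟩ fun v hv => ?_
      change h v v = h (l v) v
      rw [hl_self v hv]
    · intro x hx y hy
      have hadj : ∀ {v w x y : T.V}, T.Below v x → T.Below w y → T.graph.Adj x y →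
          ∃ z, T.Below v z ∧ T.Below w z := by
        intro v w x y hv hw hxy
        rcases isChild_or_isChild_of_adj hxy with hc | hc
        · exact ⟨y, hv.trans hc.below, hw⟩
        · exact ⟨x, hv, hw.trans hc.below⟩
      by_cases hxy : l x = l y
      · rw [hxy]
        exact (h (l y)).map_adj_iff
      · constructor
        · intro hA'
          obtain ⟨z, hz, hz'⟩ := hadj (hψ x hx) (hψ y hy) hA'
          exact absurd (hl_of x hx y hy z hz hz') hxy
        · intro hA'
          obtain ⟨z, hz, hz'⟩ := hadj (hlx x hx) (hlx y hy) hA'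
          exact absurd (hA.eq_of_below_leaves (hl x hx) (hl y hy) hz hz') hxy
  refine Set.mem_iUnion.2 ⟨0, fun x => h (l x) x, ?_⟩
  rw [nbhd_zero]
  refine ⟨hiso, fun v hv => ⟨h v, hU v hv, fun x hx => ?_⟩, fun ω => ?_⟩
  · rw [hl_eq v hv x hx]
  · obtain ⟨n, hn⟩ := hA.exists_mem_leaves ω
    have h1 := hray _ hn ω (by rw [Boundary.depth_apply])
    rw [Boundary.depth_apply] at h1
    refine ⟨n, T.depth (h (ω.toFun n) (ω.toFun n)), fun j => ?_⟩
    rw [add_comm j, add_comm j, h1]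
    change h (l _) _ = _
    rw [hl_eq _ hn _ (ω.below (by omega))]

lemma finite_below (x : T.V) : {u | T.Below u x}.Finite := by
  refine ((Set.finite_Iic (T.depth x)).biUnion fun j _ => finite_sphere (T := T) j).subset ?_
  intro u hu
  exact Set.mem_biUnion (show T.depth u ∈ Set.Iic (T.depth x) from Below.depth_le hu) rfl

/-- A homeomorphism carrying all `C_v`, `v` in a sphere, to sets `C_w`, determines a finite complete
subtree with these `w` as leaves. -/
lemma exists_isFiniteComplete_leaves (hd : 2 ≤ d) {f : T.Boundary ≃ₜ T.Boundary} {R : ℕ}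
    {w : T.V → T.V} (hw : ∀ v, T.depth v = R → Carries F f v (w v)) :
    ∃ A, T.IsFiniteComplete A ∧ T.leaves A = w '' {v | T.depth v = R} := by
  have hanti : ∀ v v', T.depth v = R → T.depth v' = R → T.Below (w v) (w v') → v = v' := by
    intro v v' hv hv' hvv
    obtain ⟨η, hη⟩ := Boundary.exists_apply_eq hd (w v')
    have h1 := (hw v' hv').symm.apply_eq hη
    have h2 := (hw v hv).symm.apply_eq (Boundary.apply_depth_of_below (hη.symm ▸ hvv))
    rw [hv] at h2
    rw [hv'] at h1
    exact h2.symm.trans h1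
  refine ⟨{u | ∃ v, T.depth v = R ∧ T.Below u (w v)}, ⟨?_, ?_, ?_, ?_⟩, ?_⟩
  · refine ((finite_sphere (T := T) R).biUnion fun v _ => finite_below (w v)).subset ?_
    rintro u ⟨v, hv, hu⟩
    exact Set.mem_biUnion (show v ∈ {v | T.depth v = R} from hv) hu
  · obtain ⟨ω, -⟩ := Boundary.exists_apply_eq hd T.root
    exact ⟨ω.toFun R, ω.depth_apply R, root_below _⟩
  · rintro x ⟨v, hv, hx⟩ u hu
    exact ⟨v, hv, hu.trans hx⟩
  · rintro u hu hnl c hc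
    obtain ⟨c', hc', v', hv', hcv⟩ : ∃ c', T.IsChild u c' ∧
        ∃ v, T.depth v = R ∧ T.Below c' (w v) := by
      by_contra! hcon
      exact hnl ⟨hu, fun c' hc' ⟨v, hv, hcv⟩ => hcon c' hc' v hv hcv⟩
    obtain ⟨η, hη⟩ := Boundary.exists_apply_eq hd c
    have hv := (f.symm η).depth_apply R
    have h1 := (hw _ hv).apply_eq (ω := f.symm η) (by rw [hv])
    rw [f.apply_symm_apply] at h1
    set v := (f.symm η).toFun R
    rcases le_or_gt (T.depth c) (T.depth (w v)) with h2 | h2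
    · refine ⟨v, hv, ?_⟩
      have := η.below h2
      rwa [h1, hη] at this
    · have h3 := η.below (Nat.le_of_lt h2)
      rw [h1, hη] at h3
      have h4 := h3.of_isChild (by intro h; rw [h] at h2; omega) hc
      have h5 := hanti v v' hv hv' ((h4.trans hc'.below).trans hcv)
      have h6 := h4.depth_le
      have h7 := hcv.depth_le
      rw [h5] at h6
      have := hc'.depth_eq
      omega
  · ext u
    constructor
    · rintro ⟨⟨v, hv, hu⟩, hu'⟩
      refine ⟨v, hv, ?_⟩
      by_contra hne
      obtain ⟨c, hc, hcv⟩ := hu.exists_isChild (Ne.symm hne)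
      exact hu' c hc ⟨v, hv, hcv⟩
    · rintro ⟨v, hv, rfl⟩
      refine ⟨⟨v, hv, Below.refl _⟩, ?_⟩
      rintro c hc ⟨v', hv', hcv⟩
      have h5 := hanti v v' hv hv' (hc.below.trans hcv)
      have h7 := hcv.depth_le
      rw [← h5] at h7
      have := hc.depth_eq
      omega

lemma NeretinGroup.exists_carries (f : T.NeretinGroup F) (ω : T.Boundary) :
    ∃ n m, Carries F f.toHomeo (ω.toFun n) ((f.toHomeo ω).toFun m) :=
  exists_carries_of_mem_fullGroup f.2 ω

lemma exists_mem_OGroup_of_hasShift (hd : 2 ≤ d) (f : T.NeretinGroup F) {o : T.NeretinGroup F}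
    (ho : HasShift F o.toHomeo fun _ => 0) :
    ∃ A, T.IsFiniteComplete A ∧ f * o * f⁻¹ ∈ OGroup F A := by
  obtain ⟨R, -, hR⟩ := exists_uniform_depth (T := T)
    (P := fun v => (∃ w, Carries F f.toHomeo v w) ∧
      ∃ w, Carries F o.toHomeo v w ∧ T.depth w = T.depth v)
    (by
      rintro v v' hv ⟨⟨w, hw⟩, u, hu, hud⟩
      obtain ⟨w', hw', -⟩ := hw.below hv.below
      obtain ⟨u', hu', hud'⟩ := hu.below hv.below
      exact ⟨⟨w', hw'⟩, u', hu', by omega⟩)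
    (by
      intro ω
      obtain ⟨n, m, h1⟩ := f.exists_carries ω
      obtain ⟨n', m', h2, h3⟩ := ho ω
      have h4 : (0 : ℤ) = m' - n' := h3 ω rfl
      obtain rfl : m' = n' := by omega
      have h1' := h1.shift m'
      have h2' := h2.shift n
      rw [add_comm m' n] at h2'
      exact ⟨n + m', ⟨_, h1'⟩, _, h2', by rw [Boundary.depth_apply, Boundary.depth_apply]⟩) 0
  have hf : ∀ v, T.depth v = R → ∃ w, Carries F f.toHomeo v w := fun v hv => (hR v hv).1
  choose! w hw using hf
  obtain ⟨A, hA, hleaves⟩ := exists_isFiniteComplete_leaves hd hw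
  refine ⟨A, hA, mem_OGroup_of_carries hd hA ?_⟩
  rw [hleaves]
  rintro _ ⟨v, hv, rfl⟩
  obtain ⟨v', hv', hvd⟩ := (hR v hv).2
  rw [show T.depth v = R from hv] at hvd
  exact ⟨w v', ⟨v', hvd, rfl⟩, ((hw v hv).symm.comp hv').comp (hw v' hvd)⟩

end ColouredTree

namespace ColouredTree

variable {d : ℕ} {T : ColouredTree.{u} d} {F : Subgroup (Equiv.Perm (Fin (d + 1)))}

/-! ### Colour-preserving automorphisms -/

/-- The map `f` preserves adjacency and the colours of edges. -/
def PreservesColours (T : ColouredTree.{u} d) (f : T.V → T.V) : Prop :=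
  ∀ u w, T.graph.Adj u w → T.graph.Adj (f u) (f w) ∧ T.col s(f u, f w) = T.col s(u, w)

lemma PreservesColours.comp {f g : T.V → T.V} (hf : T.PreservesColours f)
    (hg : T.PreservesColours g) : T.PreservesColours (g ∘ f) := fun u w h =>
  ⟨(hg _ _ (hf u w h).1).1, (hg _ _ (hf u w h).1).2.trans (hf u w h).2⟩

lemma PreservesColours.eq_id {f : T.V → T.V} (hf : T.PreservesColours f) {x : T.V}
    (hx : f x = x) (y : T.V) : f y = y := by
  obtain ⟨p⟩ := T.isTree.connected x y
  induction p with
  | nil => exact hx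
  | cons h p ih =>
    refine ih ?_
    obtain ⟨h1, h2⟩ := hf _ _ h
    rw [← nb_col h1, h2, hx, nb_col h]

/-- The image of `z` at depth `n` under the colour-preserving map taking the root to `y`. -/
noncomputable def developAux (y : T.V) : ℕ → T.V → T.V
  | 0, _ => y
  | n + 1, z => nb (developAux y n (par z)) (T.col s(par z, z))

lemma exists_preservesColours_root (T : ColouredTree.{u} d) (y : T.V) :
    ∃ f, T.PreservesColours f ∧ f T.root = y := by
  have key : ∀ u w, T.IsChild u w → developAux y (T.depth w) w =
      nb (developAux y (T.depth u) u) (T.col s(u, w)) := fun u w h => by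
    rw [h.depth_eq, developAux, h.par_eq]
  refine ⟨fun z => developAux y (T.depth z) z, fun u w h => ?_, by simp [developAux]⟩
  rcases isChild_or_isChild_of_adj h with h1 | h1
  · simp only [key u w h1]
    exact ⟨adj_nb _ _, col_nb _ _⟩
  · simp only [key w u h1]
    rw [show s(u, w) = s(w, u) from Sym2.eq_swap]
    exact ⟨(adj_nb _ _).symm, by rw [Sym2.eq_swap, col_nb]⟩

lemma exists_preservesColours (x y : T.V) : ∃ f, T.PreservesColours f ∧ f x = y :=
  exists_preservesColours_root { T with root := x } y

lemma exists_mem_universalGroup (F : Subgroup (Equiv.Perm (Fin (d + 1)))) (x y : T.V) :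
    ∃ h ∈ T.universalGroup F, h x = y ∧ T.PreservesColours h := by
  obtain ⟨f, hf, hfx⟩ := exists_preservesColours x y
  obtain ⟨g, hg, hgy⟩ := exists_preservesColours y x
  have hgf : ∀ z, g (f z) = z := (hf.comp hg).eq_id (x := x) (by simp [hfx, hgy])
  have hfg : ∀ z, f (g z) = z := (hg.comp hf).eq_id (x := y) (by simp [hfx, hgy])
  refine ⟨⟨⟨f, g, hgf, hfg⟩, fun {u w} => ⟨fun h => ?_, fun h => (hf u w h).1⟩⟩, fun v =>
    ⟨1, F.one_mem, fun w h => (hf v w h).2⟩, hfx, hf⟩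
  have := (hg _ _ h).1
  change T.graph.Adj (g (f u)) (g (f w)) at this
  rwa [hgf, hgf] at this

/-! ### Swapping two subtrees -/

lemma exists_swap {h : T.graph ≃g T.graph} (hh : h ∈ T.universalGroup F) {x y : T.V} (hxy : x ≠ y)
    (hx : x ≠ T.root) (hy : y ≠ T.root) (hdep : T.depth x = T.depth y) (hhx : h x = y)
    (hhp : h (par x) = par y) :
    ∃ k : T.Boundary ≃ₜ T.Boundary, Carries F k x y ∧ Carries F k y x ∧
      ∀ ω : T.Boundary, ω.toFun (T.depth x) ≠ x → ω.toFun (T.depth x) ≠ y → k ω = ω := by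
  have e1 : h⁻¹ y = x := by
    rw [← hhx]
    exact h.symm_apply_apply x
  have e2 : h⁻¹ (par y) = par x := by
    rw [← hhp]
    exact h.symm_apply_apply _
  have hex : ∀ ω : T.Boundary, ∃ η : T.Boundary,
      (ω.toFun (T.depth x) = x → ∀ n, η.toFun (T.depth y + n) = h (ω.toFun (T.depth x + n))) ∧
      (ω.toFun (T.depth y) = y → ∀ n, η.toFun (T.depth x + n) = h⁻¹ (ω.toFun (T.depth y + n))) ∧
      (ω.toFun (T.depth x) ≠ x → ω.toFun (T.depth x) ≠ y → η = ω) := by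
    intro ω
    by_cases h1 : ω.toFun (T.depth x) = x
    · obtain ⟨η, hη⟩ := exists_image_ray (h := h) (by rw [hhp, hhx]) h1
      rw [hhx] at hη
      refine ⟨η, fun _ => hη, fun h2 => ?_, fun h2 => absurd h1 h2⟩
      rw [← hdep, h1] at h2
      exact absurd h2 hxy
    · by_cases h2 : ω.toFun (T.depth y) = y
      · obtain ⟨η, hη⟩ := exists_image_ray (h := h⁻¹) (by rw [e2, e1]) h2
        rw [e1] at hη
        refine ⟨η, fun h3 => absurd h3 h1, fun _ => hη, fun _ h3 => ?_⟩
        rw [hdep] at h3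
        exact absurd h2 h3
      · exact ⟨ω, fun h3 => absurd h3 h1, fun h3 => absurd h3 h2, fun _ _ => rfl⟩
  choose k hkx hky hk using hex
  have hcx : Carries F k x y := ⟨hx, hy, h, hh, hhx, hhp, hkx⟩
  have hcy : Carries F k y x := ⟨hy, hx, h⁻¹, inv_mem hh, e1, e2, hky⟩
  have hinv : Function.Involutive k := by
    intro ω
    by_cases h1 : ω.toFun (T.depth x) = x
    · refine Boundary.ext_tail (T.depth x) fun n => ?_
      rw [hky _ (hcx.apply_eq h1), hkx ω h1]
      exact h.symm_apply_apply _
    · by_cases h2 : ω.toFun (T.depth y) = y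
      · refine Boundary.ext_tail (T.depth y) fun n => ?_
        rw [hkx _ (hcy.apply_eq h2), hky ω h2]
        exact h.apply_symm_apply _
      · have h3 := hk ω h1 (by rwa [hdep])
        rw [h3, h3]
  have hcont : Continuous k := by
    refine continuous_of_carries (F := F) fun ω => ⟨T.depth x, ?_⟩
    by_cases h1 : ω.toFun (T.depth x) = x
    · exact ⟨y, by rwa [h1]⟩
    · by_cases h2 : ω.toFun (T.depth x) = y
      · exact ⟨x, by rwa [h2]⟩
      · refine ⟨ω.toFun (T.depth x), ω.apply_ne_root (depth_pos.2 hx),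
          ω.apply_ne_root (depth_pos.2 hx), 1, one_mem _, rfl, rfl, fun η hη n => ?_⟩
        rw [Boundary.depth_apply] at hη
        rw [hk η (by rwa [hη]) (by rwa [hη])]
        rfl
  exact ⟨⟨hinv.toPerm, hcont, hcont⟩, hcx, hcy, hk⟩

lemma exists_swap_below (hd : 2 ≤ d) (F : Subgroup (Equiv.Perm (Fin (d + 1)))) {s : T.V}
    (hs : s ≠ T.root) : ∃ k : T.NeretinGroup F, HasShift F k.toHomeo (fun _ => 0) ∧
      (∀ ω : T.Boundary, ω.toFun (T.depth s) ≠ s → k.toHomeo ω = ω) ∧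
      ∃ ω η : T.Boundary, ω.toFun (T.depth s) = s ∧ η.toFun (T.depth s) = s ∧
        ω.toFun (T.depth s + 1) = η.toFun (T.depth s + 1) ∧
        (k.toHomeo ω).toFun (T.depth s + 1) ≠ (k.toHomeo η).toFun (T.depth s + 1) := by
  set e := T.col s(par s, s) with he
  obtain ⟨p, hp, -⟩ := exists_isChild_ne hd s s
  obtain ⟨q, hq, hqp⟩ := exists_isChild_ne hd s p
  have hcol : ∀ {p}, T.IsChild s p → T.col s(s, p) ≠ e := fun {p} hp h => by
    refine (T.legal s p (par s) hp.1 (isChild_par hs).1.symm ?_) ?_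
    · rintro rfl
      have h1 := hp.depth_eq
      have h2 := (isChild_par hs).depth_eq
      omega
    · rw [h, he, Sym2.eq_swap]
  have hchild : ∀ {p c}, T.IsChild s p → c ≠ T.col s(s, p) → T.IsChild p (nb p c) :=
    fun {p c} hp hc => isChild_nb (by rwa [hp.par_eq])
  have hx := hchild hp (hcol hp).symm
  have hy := hchild hq (hcol hq).symm
  have hpq : T.col s(s, q) ≠ T.col s(s, p) := T.legal s q p hq.1 hp.1 hqp
  have hz := hchild hp hpq
  set x := nb p e with hxdef
  set y := nb q e with hydef
  set z := nb p (T.col s(s, q)) with hzdef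
  have hzx : z ≠ x := fun h => hcol hq (nb_injective p h)
  have hdp := hp.depth_eq
  have hdq := hq.depth_eq
  have hdx := hx.depth_eq
  have hdy := hy.depth_eq
  have hdz := hz.depth_eq
  have hxy : x ≠ y := by
    intro h
    rw [← h] at hy
    exact hqp (hy.eq_of hx)
  have hzy : z ≠ y := by
    intro h
    rw [← h] at hy
    exact hqp (hy.eq_of hz)
  obtain ⟨h, hh, hhx, hhc⟩ := exists_mem_universalGroup F x y
  have hhp : h p = q := by
    obtain ⟨h1, h2⟩ := hhc x p hx.1.symm
    have h3 : T.col s(x, p) = e := by rw [Sym2.eq_swap, hxdef, col_nb]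
    have h4 : T.col s(y, q) = e := by rw [Sym2.eq_swap, hydef, col_nb]
    rw [← nb_col h1, h2, hhx, h3, ← h4, nb_col hy.1.symm]
  obtain ⟨k, hkx, hky, hk⟩ := exists_swap hh hxy hx.ne_root hy.ne_root (by omega) hhx
    (by rw [hx.par_eq, hy.par_eq, hhp])
  have hcar : ∀ ω : T.Boundary, ∃ w, Carries F k (ω.toFun (T.depth x)) w ∧
      T.depth w = T.depth x := by
    intro ω
    by_cases h1 : ω.toFun (T.depth x) = x
    · exact ⟨y, by rwa [h1], by omega⟩
    · by_cases h2 : ω.toFun (T.depth x) = y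
      · exact ⟨x, by rwa [h2], rfl⟩
      · refine ⟨ω.toFun (T.depth x), ⟨ω.apply_ne_root (depth_pos.2 hx.ne_root),
          ω.apply_ne_root (depth_pos.2 hx.ne_root), 1, one_mem _, rfl, rfl, fun η hη n => ?_⟩,
          ω.depth_apply _⟩
        rw [Boundary.depth_apply] at hη
        rw [hk η (by rwa [hη]) (by rwa [hη])]
        rfl
  obtain ⟨ω, hω⟩ := Boundary.exists_apply_eq hd x
  obtain ⟨η, hη⟩ := Boundary.exists_apply_eq hd z
  have hbelow : ∀ {ω : T.Boundary} {u v : T.V}, ω.toFun (T.depth u) = u → T.Below v u →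
      ω.toFun (T.depth v) = v := fun {ω u v} h1 h2 =>
    Boundary.apply_depth_of_below (n := T.depth u) (by rwa [h1])
  refine ⟨⟨k, mem_fullGroup_of_carries fun ω => ?_⟩, fun ω => ?_, fun ω hω => ?_, ω, η, ?_, ?_, ?_,
    ?_⟩
  · obtain ⟨w, hw, -⟩ := hcar ω
    exact ⟨_, w, hw⟩
  · obtain ⟨w, hw, hw'⟩ := hcar ω
    refine ⟨T.depth x, T.depth x, ?_, fun _ _ => by simp⟩
    have h1 := hw.apply_eq (ω := ω) (by rw [Boundary.depth_apply])
    rw [hw'] at h1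
    change Carries F k _ ((k ω).toFun _)
    rwa [h1]
  · refine hk ω (fun h1 => hω ?_) (fun h1 => hω ?_)
    · exact hbelow h1 (hp.below.trans hx.below)
    · rw [show T.depth x = T.depth y by omega] at h1
      exact hbelow h1 (hq.below.trans hy.below)
  · exact hbelow hω (hp.below.trans hx.below)
  · exact hbelow hη (hp.below.trans hz.below)
  · rw [← hdp, hbelow hω hx.below, hbelow hη hz.below]
  · change (k ω).toFun _ ≠ (k η).toFun _
    rw [show T.depth x = T.depth z by omega] at hk
    rw [hk η (by rwa [hη]) (by rwa [hη]), ← hdp, hbelow hη hz.below, hdp, ← hdq,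
      hbelow (hkx.apply_eq hω) hy.below]
    exact hqp

/-- Below any vertex there is an infinite family of vertices with pairwise disjoint subtrees. -/
lemma exists_disjoint_below (hd : 2 ≤ d) (v : T.V) :
    ∃ s : ℕ → T.V, (∀ i, T.Below v (s i) ∧ s i ≠ T.root) ∧
      ∀ i j, i ≠ j → ∀ ω : T.Boundary, ω.toFun (T.depth (s i)) = s i →
        ω.toFun (T.depth (s j)) ≠ s j := by
  obtain ⟨η, hη⟩ := Boundary.exists_apply_eq hd v
  have hex : ∀ i, ∃ s, T.IsChild (η.toFun (T.depth v + i)) s ∧ s ≠ η.toFun (T.depth v + i + 1) :=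
    fun i => exists_isChild_ne hd _ _
  choose s hs hs' using hex
  have hdep : ∀ i, T.depth (s i) = T.depth v + i + 1 := fun i => by
    rw [(hs i).depth_eq, Boundary.depth_apply]
  have key : ∀ i j, i < j → ∀ ω : T.Boundary, ω.toFun (T.depth (s i)) = s i →
      ω.toFun (T.depth (s j)) ≠ s j := by
    intro i j hij ω h1 h2
    rw [hdep] at h1 h2
    have h3 := (hs j).par_eq
    rw [← h2, Boundary.par_apply_succ] at h3
    have h4 := Boundary.apply_eq_of_le h3 (m := T.depth v + i + 1) (by omega)
    exact hs' i (h1.symm.trans h4)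
  refine ⟨s, fun i => ⟨?_, (hs i).ne_root⟩, fun i j hij ω h1 h2 => ?_⟩
  · have := η.below (show T.depth v ≤ T.depth v + i by omega)
    rw [hη] at this
    exact this.trans (hs i).below
  · rcases lt_or_gt_of_ne hij with h | h
    · exact key i j h ω h1 h2
    · exact key j i h ω h2 h1

end ColouredTree

/-! ### Invariant random subgroups and open sets -/

namespace ClosedSubgroup

variable {G : Type u} [Group G] [TopologicalSpace G]

/-- The closed subgroups that meet `W`. -/
def hit (W : Set G) : Set (ClosedSubgroup G) := {H | ((H : Set G) ∩ W).Nonempty}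

lemma measurableSet_hit {W : Set G} (hW : IsOpen W) : MeasurableSet (hit W) := by
  have : BorelSpace (ClosedSubgroup G) := ⟨rfl⟩
  exact IsOpen.measurableSet (TopologicalSpace.isOpen_generateFrom_of_mem (Or.inr ⟨W, hW, rfl⟩))

lemma ext_mem {H K : ClosedSubgroup G} (h : ∀ x, x ∈ H ↔ x ∈ K) : H = K := SetLike.ext h

variable [SeparatelyContinuousMul G]

lemma mem_conj {g x : G} {H : ClosedSubgroup G} : x ∈ conj g H ↔ g⁻¹ * x * g ∈ H := by
  change g⁻¹ * x * g⁻¹⁻¹ ∈ H ↔ _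
  rw [inv_inv]

lemma conj_preimage_hit (g : G) (W : Set G) :
    conj g ⁻¹' hit W = hit {z | g * z * g⁻¹ ∈ W} := by
  ext H
  constructor
  · rintro ⟨x, hx, hxW⟩
    refine ⟨g⁻¹ * x * g, mem_conj.1 hx, ?_⟩
    have e : g * (g⁻¹ * x * g) * g⁻¹ = x := by group
    rwa [Set.mem_ofPred_eq, e]
  · rintro ⟨z, hz, hzW⟩
    refine ⟨g * z * g⁻¹, mem_conj.2 ?_, hzW⟩
    have e : g⁻¹ * (g * z * g⁻¹) * g = z := by group
    rwa [e]

lemma isOpen_conj_mem (g : G) {W : Set G} (hW : IsOpen W) : IsOpen {z | g * z * g⁻¹ ∈ W} :=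
  hW.preimage ((continuous_mul_const g⁻¹).comp (continuous_const_mul g))

/-- If infinitely many conjugates of an open set `W` are such that almost no subgroup meets two of
them, then almost no subgroup meets `W`. -/
lemma IsErgodicIRS.measure_hit_eq_zero {μ : Measure (ClosedSubgroup G)} (hμ : IsErgodicIRS μ)
    {W : Set G} (hW : IsOpen W) (k : ℕ → G)
    (h : ∀ i j, i ≠ j → μ (conj (k i) ⁻¹' hit W ∩ conj (k j) ⁻¹' hit W) = 0) :
    μ (hit W) = 0 := by
  by_contra hpos
  have := hμ.isProbabilityMeasure
  have hsum : μ (⋃ i, conj (k i) ⁻¹' hit W) = ∑' i, μ (conj (k i) ⁻¹' hit W) := by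
    refine measure_iUnion₀ (fun i j hij => h i j hij) fun i => ?_
    rw [conj_preimage_hit]
    exact (measurableSet_hit (isOpen_conj_mem _ hW)).nullMeasurableSet
  simp only [hμ.invariant _ _ (measurableSet_hit hW)] at hsum
  rw [ENNReal.tsum_const_eq_top_of_ne_zero hpos] at hsum
  exact measure_ne_top μ _ hsum

lemma eq_dirac_of_ae_eq {X : Type*} [MeasurableSpace X] {μ : Measure X} [IsProbabilityMeasure μ]
    {a : X} (h : ∀ᵐ x ∂μ, x = a) : μ = Measure.dirac a := by
  ext S hS
  rw [Measure.dirac_apply' _ hS]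
  by_cases ha : a ∈ S
  · rw [Set.indicator_of_mem ha, Pi.one_apply, ← prob_compl_eq_zero_iff hS]
    exact measure_mono_null (fun x hx (hxa : x = a) => hx (hxa ▸ ha)) h
  · rw [Set.indicator_of_notMem ha]
    exact measure_mono_null (fun x hx (hxa : x = a) => ha (hxa ▸ hx)) h

end ClosedSubgroup

namespace ColouredTree

open ClosedSubgroup

variable {d : ℕ} {T : ColouredTree.{u} d} {F : Subgroup (Equiv.Perm (Fin (d + 1)))}

namespace NeretinGroup

lemma isOpen_of_stab_mul {S : Set (T.NeretinGroup F)}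
    (h : ∀ φ ∈ S, ∃ L : Set T.V, L.Finite ∧ ∀ y ∈ stab F L, y * φ ∈ S) : IsOpen S := by
  refine isOpen_iff_forall_mem_open.2 fun φ hφ => ?_
  obtain ⟨L, hL, hLS⟩ := h φ hφ
  refine ⟨{x | ∃ y ∈ stab F L, x = 1 * y * φ}, ?_,
    TopologicalSpace.isOpen_generateFrom_of_mem ⟨1, φ, L, hL, rfl⟩,
    ⟨1, ⟨1, one_mem _, fun _ _ => rfl, fun ω => IsImage.id ω⟩, by simp⟩⟩
  rintro _ ⟨y, hy, rfl⟩
  rw [one_mul]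
  exact hLS y hy

lemma hasShift_of_mem_stab (hd : 2 ≤ d) {L : Set T.V} (hL : T.root ∈ L) {y : T.NeretinGroup F}
    (hy : y ∈ stab F L) : HasShift F y.toHomeo fun _ => 0 := by
  obtain ⟨g, hg, hfix, hind⟩ := hy
  intro ω
  have h1 := carries_of_induces hg (hfix _ hL) hind (ω.apply_ne_root le_rfl : ω.toFun 1 ≠ T.root) hd
  rw [(hind ω).apply_eq (hfix _ hL)] at h1
  exact ⟨1, 1, h1.1, fun _ _ => by simp⟩

/-- The elements that preserve depths near every point of the boundary. -/
def depthPreserving (T : ColouredTree.{u} d) (F : Subgroup (Equiv.Perm (Fin (d + 1)))) :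
    Set (T.NeretinGroup F) :=
  {o | HasShift F o.toHomeo fun _ => 0}

lemma isOpen_depthPreserving (hd : 2 ≤ d) : IsOpen (depthPreserving T F) := by
  refine isOpen_of_stab_mul fun φ hφ => ⟨{T.root}, Set.finite_singleton _, fun y hy => ?_⟩
  exact ((hasShift_of_mem_stab hd (Set.mem_singleton _) hy).comp hφ).congr fun _ => add_zero _

/-- The nontrivial conjugates of depth-preserving elements. -/
def elliptic (T : ColouredTree.{u} d) (F : Subgroup (Equiv.Perm (Fin (d + 1)))) :
    Set (T.NeretinGroup F) :=
  {φ | φ ≠ 1 ∧ ∃ f, f * φ * f⁻¹ ∈ depthPreserving T F}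

lemma isOpen_elliptic (hd : 2 ≤ d) : IsOpen (elliptic T F) := by
  have : elliptic T F = {1}ᶜ ∩ ⋃ f, {φ | f * φ * f⁻¹ ∈ depthPreserving T F} := by
    ext φ
    simp [elliptic]
  rw [this]
  exact isClosed_singleton.isOpen_compl.inter
    (isOpen_iUnion fun f => isOpen_conj_mem f (isOpen_depthPreserving hd))

lemma conj_mem_elliptic {g φ : T.NeretinGroup F} :
    g * φ * g⁻¹ ∈ elliptic T F ↔ φ ∈ elliptic T F := by
  have key : ∀ (g φ : T.NeretinGroup F), φ ∈ elliptic T F → g * φ * g⁻¹ ∈ elliptic T F := by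
    rintro g φ ⟨h1, f, hf⟩
    refine ⟨fun h => h1 (conj_eq_one_iff.1 h), f * g⁻¹, ?_⟩
    have e : f * g⁻¹ * (g * φ * g⁻¹) * (f * g⁻¹)⁻¹ = f * φ * f⁻¹ := by group
    rwa [e]
  refine ⟨fun h => ?_, key g φ⟩
  have e : g⁻¹ * (g * φ * g⁻¹) * g⁻¹⁻¹ = φ := by group
  rw [← e]
  exact key _ _ h

/-- The elements with shift `c` that carry `C_v` off itself by an element of `U(F)`, the function `c`
being constant on `C_v`. -/
def moving (F : Subgroup (Equiv.Perm (Fin (d + 1)))) (c : T.Boundary → ℤ) (v : T.V) :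
    Set (T.NeretinGroup F) :=
  {φ | HasShift F φ.toHomeo c ∧ (∃ w, Carries F φ.toHomeo v w ∧
      ∀ ω : T.Boundary, ω.toFun (T.depth v) = v → c ω = T.depth w - T.depth v) ∧
    ∀ ω : T.Boundary, ω.toFun (T.depth v) = v → (φ.toHomeo ω).toFun (T.depth v) ≠ v}

lemma isOpen_moving (hd : 2 ≤ d) (c : T.Boundary → ℤ) (v : T.V) : IsOpen (moving F c v) := by
  refine isOpen_of_stab_mul fun φ hφ => ⟨{T.root, v}, by simp, fun y hy => ?_⟩
  obtain ⟨h1, ⟨w, hw, hc⟩, h3⟩ := hφ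
  have hy0 := hasShift_of_mem_stab hd (by simp) hy
  obtain ⟨g, hg, hfix, hind⟩ := hy
  have hroot := hfix T.root (by simp)
  refine ⟨(hy0.comp h1).congr fun _ => zero_add _, ?_, fun ω hω h => h3 ω hω ?_⟩
  · obtain ⟨h4, h5⟩ := carries_of_induces hg hroot hind hw.2.1 hd
    exact ⟨g w, hw.comp h4, by rwa [h5]⟩
  · refine g.injective ?_
    rw [(hind _).apply_eq hroot, hfix v (by simp)]
    exact h

lemma exists_mem_moving {φ : T.NeretinGroup F} (hφ : φ ≠ 1) :
    ∃ c ∈ levelFunctions T, ∃ v, φ ∈ moving F c v := by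
  obtain ⟨c, hc, hφc⟩ := exists_hasShift φ.2
  obtain ⟨ω, hω⟩ : ∃ ω, φ.toHomeo ω ≠ ω := by
    by_contra! hcon
    exact hφ (Subtype.ext (Homeomorph.ext hcon))
  obtain ⟨N, hN⟩ : ∃ n, (φ.toHomeo ω).toFun n ≠ ω.toFun n := by
    by_contra! hcon
    exact hω (Boundary.ext (funext hcon))
  obtain ⟨n, m, h1, h2⟩ := hφc ω
  refine ⟨c, hc, ω.toFun (n + N), hφc, ⟨_, h1.shift N, fun η hη => ?_⟩, fun η hη h => hN ?_⟩
  · rw [Boundary.depth_apply] at hη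
    rw [h2 η (Boundary.apply_eq_of_le hη (by omega)), Boundary.depth_apply, Boundary.depth_apply]
    push_cast
    ring
  · have h3 := (h1.shift N).apply_eq hη
    rw [Boundary.depth_apply] at h3 h
    have h4 := Boundary.apply_eq_of_le h3 (m := N) (by omega)
    have h5 := Boundary.apply_eq_of_le h (m := N) (by omega)
    exact h4.symm.trans h5

lemma apply_mem_of_support {k : T.Boundary ≃ₜ T.Boundary} {v : T.V}
    (hk : ∀ ω : T.Boundary, ω.toFun (T.depth v) ≠ v → k ω = ω) {ω : T.Boundary}
    (hω : ω.toFun (T.depth v) = v) : (k ω).toFun (T.depth v) = v := by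
  by_contra h
  have := k.injective (hk _ h)
  rw [this] at h
  exact h hω

lemma hasShift_conj {c : T.Boundary → ℤ} {v : T.V} {g k : T.NeretinGroup F}
    (hg : g ∈ moving F c v) (hk : HasShift F k.toHomeo fun _ => 0)
    (hsupp : ∀ ω : T.Boundary, ω.toFun (T.depth v) ≠ v → k.toHomeo ω = ω) :
    HasShift F (k⁻¹ * g * k).toHomeo c := by
  obtain ⟨h1, ⟨w, -, hc⟩, -⟩ := hg
  refine (hk.symm.comp (h1.comp hk)).congr fun ω => ?_
  simp only [neg_zero, zero_add, add_zero]
  by_cases hω : ω.toFun (T.depth v) = v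
  · rw [hc _ hω, hc _ (apply_mem_of_support hsupp hω)]
  · rw [hsupp ω hω]

lemma measure_hit_moving (hd : 2 ≤ d) {μ : Measure (ClosedSubgroup (T.NeretinGroup F))}
    (hμ : IsErgodicIRS μ) (h0 : μ (hit (elliptic T F)) = 0) (c : T.Boundary → ℤ) (v : T.V) :
    μ (hit (moving F c v)) = 0 := by
  obtain ⟨s, hs, hdisj⟩ := exists_disjoint_below hd v
  choose k hk0 hks a b ha hb hab hkab using fun i => exists_swap_below hd F (hs i).2
  have hsv : ∀ i (ω : T.Boundary), ω.toFun (T.depth (s i)) = s i → ω.toFun (T.depth v) = v :=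
    fun i ω hω => Boundary.apply_depth_of_below (n := T.depth (s i)) (by rw [hω]; exact (hs i).1)
  have hkv : ∀ i (ω : T.Boundary), ω.toFun (T.depth v) ≠ v → (k i).toHomeo ω = ω :=
    fun i ω hω => hks i ω fun h => hω (hsv i ω h)
  refine hμ.measure_hit_eq_zero (isOpen_moving hd c v) k fun i j hij =>
    measure_mono_null ?_ h0
  rintro H ⟨⟨g, hgH, hg⟩, ⟨g', hgH', hg'⟩⟩
  have hH : (k i)⁻¹ * g * k i ∈ H := mem_conj.1 hgH
  have hH' : (k j)⁻¹ * g' * k j ∈ H := mem_conj.1 hgH'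
  have hsh := hasShift_conj hg (hk0 i) (hkv i)
  have hsh' := hasShift_conj hg' (hk0 j) (hkv j)
  refine ⟨(k i)⁻¹ * g * k i * ((k j)⁻¹ * g' * k j)⁻¹, H.toSubgroup.mul_mem hH
    (H.toSubgroup.inv_mem hH'), fun hone => ?_, 1, ?_⟩
  · have heq : (k i)⁻¹ * g * k i = (k j)⁻¹ * g' * k j := mul_inv_eq_one.1 hone
    obtain ⟨-, ⟨w, hw, hcw⟩, hoff⟩ := hg
    obtain ⟨-, ⟨w', hw', hcw'⟩, hoff'⟩ := hg'
    have hww : T.depth w = T.depth w' := by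
      have h1 := hcw _ (hsv i _ (ha i))
      have h2 := hcw' _ (hsv i _ (ha i))
      omega
    have happ : ∀ ω : T.Boundary, ω.toFun (T.depth (s i)) = s i →
        g.toHomeo ((k i).toHomeo ω) = g'.toHomeo ω := by
      intro ω hω
      have hωv := hsv i ω hω
      have h1 : (k i).toHomeo.symm (g.toHomeo ((k i).toHomeo ω)) =
          (k j).toHomeo.symm (g'.toHomeo ((k j).toHomeo ω)) :=
        congrArg (fun f : T.NeretinGroup F => f.toHomeo ω) heq
      have hfix : ∀ l (η : T.Boundary), η.toFun (T.depth v) ≠ v → (k l).toHomeo.symm η = η :=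
        fun l η hη => by rw [Homeomorph.symm_apply_eq, hkv l η hη]
      rw [hks j ω (hdisj i j hij ω hω), hfix j _ (hoff' ω hωv),
        hfix i _ (hoff _ (apply_mem_of_support (hkv i) hωv))] at h1
      exact h1
    obtain ⟨-, -, h, -, -, -, hh⟩ := hw
    obtain ⟨-, -, h', -, -, -, hh'⟩ := hw'
    obtain ⟨n, hn⟩ := Nat.exists_eq_add_of_le (hs i).1.depth_le
    have key : ∀ ω : T.Boundary, ω.toFun (T.depth (s i)) = s i →
        h (((k i).toHomeo ω).toFun (T.depth (s i) + 1)) = h' (ω.toFun (T.depth (s i) + 1)) := by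
      intro ω hω
      have hωv := hsv i ω hω
      rw [hn, add_assoc, ← hh _ (apply_mem_of_support (hkv i) hωv), ← hh' _ hωv, happ ω hω, hww]
    refine hkab i (h.injective ?_)
    rw [key _ (ha i), key _ (hb i), hab i]
  · rw [one_mul, inv_one, mul_one]
    exact (hsh.comp hsh'.symm).congr fun ω => add_neg_cancel _

end NeretinGroup

end ColouredTree

open ClosedSubgroup ColouredTree NeretinGroup

theorem lemma4p1 {d : ℕ} (hd : 2 ≤ d) (T : ColouredTree.{u} d)
    (F : Subgroup (Equiv.Perm (Fin (d + 1))))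
    (μ : Measure (ClosedSubgroup (T.NeretinGroup F)))
    (hμ : ClosedSubgroup.IsErgodicIRS μ)
    (hne : μ ≠ Measure.dirac (ClosedSubgroup.trivial (T.NeretinGroup F))) :
    ∀ᵐ (H : ClosedSubgroup (T.NeretinGroup F)) ∂μ, ∃ A : Set T.V, T.IsFiniteComplete A ∧
      ∃ h ∈ H, h ∈ ColouredTree.OGroup F A ∧ h ≠ 1 := by
  have := hμ.isProbabilityMeasure
  have hmeas := measurableSet_hit (isOpen_elliptic (T := T) (F := F) hd)
  have hinv : ∀ g : T.NeretinGroup F, conj g ⁻¹' hit (elliptic T F) = hit (elliptic T F) := by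
    intro g
    rw [conj_preimage_hit]
    simp only [conj_mem_elliptic]
    rfl
  rcases hμ.ergodic _ hmeas hinv with h0 | h1
  · refine absurd (eq_dirac_of_ae_eq ?_) hne
    have hnull : μ (⋃ c ∈ levelFunctions T, ⋃ v, hit (moving F c v)) = 0 :=
      (measure_biUnion_null_iff countable_levelFunctions).2 fun c _ =>
        measure_iUnion_null fun v => measure_hit_moving hd hμ h0 c v
    refine measure_mono_null (fun H hH => ?_) hnull
    obtain ⟨φ, hφ, hφ1⟩ : ∃ φ ∈ H, φ ≠ 1 := by
      by_contra! hcon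
      refine hH (ext_mem fun x => ⟨fun hx => ?_, fun hx => ?_⟩)
      · exact hcon x hx
      · rw [show x = 1 from hx]
        exact H.toSubgroup.one_mem
    obtain ⟨c, hc, v, hv⟩ := exists_mem_moving hφ1
    exact Set.mem_biUnion hc (Set.mem_iUnion.2 ⟨v, φ, hφ, hv⟩)
  · have hae := (prob_compl_eq_zero_iff hmeas).2 h1
    refine measure_mono_null (fun H hH (hH' : H ∈ hit (elliptic T F)) => hH ?_) hae
    obtain ⟨φ, hφ, hφ1, f, hf⟩ := hH'
    obtain ⟨A, hA, hmem⟩ := exists_mem_OGroup_of_hasShift hd f⁻¹ hf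
    have e : f⁻¹ * (f * φ * f⁻¹) * f⁻¹⁻¹ = φ := by group
    rw [e] at hmem
    exact ⟨A, hA, φ, hφ, hmem, hφ1⟩
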